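/- **Stirling polynomials.** For a tuple $\mathbf{k}=(k_1,\dots,k_n)$ of positive integers let $K=k_1+\cdots+k_n$. A Stirling permutation of the multiset $\{1^{k_1},\dots,n^{k_n}\}$ is an arrangement $w(1),\dots,w(K)$ of its elements such that $w(s)\ge w(i)$ whenever $w(i)=w(j)$ and $i<s<j$. An index $i$ is a descent of $w$ if $i=K$, or $i<K$ and $w(i)>w(i+1)$. Let $A_{\mathbf{k},i}$ be the number of Stirling permutations with exactly $i$ descents, and define $B_{\mathbf{k}}(m)$, $b_{\mathbf{k}}(m)$ by the power series $$\frac{\sum_{i=1}^{n}A_{\mathbf{k},i}x^i}{(1-x)^{K+1}}=\sum_{m\ge0}B_{\mathbf{k}}(m)x^m,\qquad \frac{\sum_{i=K-n+1}^{K}A_{\mathbf{k},K+1-i}x^i}{(1-x)^{K+1}}=\sum_{m\ge0}b_{\mathbf{k}}(m)x^m .$$ **Families.** Write $[N]=\{1,\dots,N\}$. For a finite family $\mathcal F$ of nonempty multisets (blocks), $\min(\mathcal F)$ is the set of the minimal elements of its blocks, and the total multiplicity of an element is the sum of its multiplicities over all blocks. A family $\mathcal F$ of blocks with elements in $[N+1]$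 is *segmented* if, for all $a<b<c$ in $[N+1]$ such that $a$ and $c$ lie in a common block, $b\in\min(\mathcal F)$. For a permutation $\sigma$ of $[N]$, $\mathrm{lmin}(\sigma)$ is the set of its left-to-right minima (the values $\sigma(p)$ with $\sigma(q)>\sigma(p)$ for all $q<p$). **Statement.** Let $k>2$ and $n\ge1$ be integers, and let $\mathbf{k}=(k,\dots,k)$ ($n$ entries). Then for every integer $m\ge0$ $$B_{\mathbf{k}}(m)=S(n+m,m),\qquad b_{\mathbf{k}}(m)=s(m,m-n),$$ where $S$ and $s$ (which depend on $k$) are the following numbers. 1. $S(N,r)$ is the number of pairs $(\pi_0,\pi_1)$ such that (a) $\pi_1$ is a partition of $[N]$ into $r$ nonempty blocks; (b) $\pi_0$ is a segmented family of $r$ nonempty multisets with elements in $[N+1]$, each element having total multiplicity at most $k-2$, and each element of $\min(\pi_0)$ having total multiplicity exactly $1$; (c) $\min(\pi_1)=\min(\pi_0)$; (d) if $[N]\setminus\min(\pi_1)$ is nonempty and $x$ is its least element, then some block of $\pi_0$ contains $1$ and $k-2$ copies of $x$. 2. $s(N,r)$ is the number of pairs $(\sigma_0,\sigma_1)$ such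 that (a) $\sigma_1$ is a permutation of $[N]$ with exactly $r$ left-to-right minima (so $s(N,r)=0$ for $r<0$); (b) $\sigma_0$ is a segmented family of $r$ nonempty multisets with elements in $[N+1]$, in which each element of $\min(\sigma_0)$ has total multiplicity exactly $1$ and every other element of $[N+1]$ has total multiplicity exactly $k-2$; (c) $\mathrm{lmin}(\sigma_1)=\min(\sigma_0)$; (d) if $[N]\setminus\mathrm{lmin}(\sigma_1)$ is nonempty and $x$ is its least element, then some block of $\sigma_0$ contains $1$ and $k-2$ copies of $x$; (e) no block of $\sigma_0$ contains two or more copies of an element other than the element $x$ of (d). -/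

import Mathlib

/-- Words `w` of length `K = k 0 + ⋯ + k (n - 1)` in the letters `0 < 1 < ⋯ < n - 1`, each letter
`a` occurring exactly `k a` times, such that `w s ≥ w i` whenever `w i = w j` and `i < s < j`:
the Stirling permutations of the multiset of type `k`. -/
def StirlingPerms {n : ℕ} (k : Fin n → ℕ) : Set (Fin (∑ a, k a) → Fin n) :=
  {w | (∀ a, (Finset.univ.filter fun p => w p = a).card = k a) ∧
    ∀ i s j, i < s → s < j → w i = w j → w i ≤ w s}

/-- The set of descent indices of a word; the last index is always a descent index. -/
def descents {n K : ℕ} (w : Fin K → Fin n) : Set (Fin K) :=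
  {p | p.val + 1 = K ∨ ∃ h : p.val + 1 < K, w ⟨p.val + 1, h⟩ < w p}

/-- The Eulerian number `A_{k,i}`: the number of Stirling permutations with `i` descents. -/
noncomputable def eulerianNumber {n : ℕ} (k : Fin n → ℕ) (i : ℕ) : ℕ :=
  {w ∈ StirlingPerms k | (descents w).ncard = i}.ncard

/-- `G_k(x) = (∑_{i=1}^n A_{k,i} x^i) / (1 - x)^(K+1)`. -/
noncomputable def stirlingSeriesG {n : ℕ} (k : Fin n → ℕ) : PowerSeries ℚ :=
  (∑ i ∈ Finset.Icc 1 n, (eulerianNumber k i : PowerSeries ℚ) * PowerSeries.X ^ i) *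
    ((1 - PowerSeries.X) ^ ((∑ a, k a) + 1))⁻¹

/-- `g_k(x) = (∑_{i=K-n+1}^K A_{k,K+1-i} x^i) / (1 - x)^(K+1)`. All `k a` are meant to be positive,
so that `n ≤ K`. -/
noncomputable def stirlingSeriesg {n : ℕ} (k : Fin n → ℕ) : PowerSeries ℚ :=
  (∑ i ∈ Finset.Icc ((∑ a, k a) - n + 1) (∑ a, k a),
      (eulerianNumber k ((∑ a, k a) + 1 - i) : PowerSeries ℚ) * PowerSeries.X ^ i) *
    ((1 - PowerSeries.X) ^ ((∑ a, k a) + 1))⁻¹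

/-- The Stirling polynomial `B_k(m)`: the coefficient of `x^m` in `G_k(x)`. -/
noncomputable def stirlingB {n : ℕ} (k : Fin n → ℕ) (m : ℕ) : ℚ :=
  PowerSeries.coeff m (stirlingSeriesG k)

/-- The Stirling polynomial `b_k(m)`: the coefficient of `x^m` in `g_k(x)`. -/
noncomputable def stirlingb {n : ℕ} (k : Fin n → ℕ) (m : ℕ) : ℚ :=
  PowerSeries.coeff m (stirlingSeriesg k)

/-- The set `min(F)` of the minimal elements of the members of a family of multisets. -/
def familyMin (F : Finset (Multiset ℕ)) : Set ℕ :=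
  {a | ∃ B ∈ F, IsLeast {y | y ∈ B} a}

/-- The merge sum of the members of a family of multisets. -/
def familySum (F : Finset (Multiset ℕ)) : Multiset ℕ :=
  ∑ B ∈ F, B

/-- `a ∼_F b`: some member of `F` contains both `a` and `b`. -/
def familyRel (F : Finset (Multiset ℕ)) (a b : ℕ) : Prop :=
  ∃ B ∈ F, a ∈ B ∧ b ∈ B

/-- `F` is segmented over the ground set `U`: if `a < b < c` in `U` and `a ∼_F c`, then `b` is the
minimum of some member of `F`. -/
def IsSegmented (U : Set ℕ) (F : Finset (Multiset ℕ)) : Prop :=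
  ∀ a ∈ U, ∀ b ∈ U, ∀ c ∈ U, a < b → b < c → familyRel F a c → b ∈ familyMin F

/-- The set of minima of the blocks of a set partition of `[N] = {1, …, N}`. -/
def partitionMin {N : ℕ} (π : Finpartition (Finset.Icc 1 N)) : Set ℕ :=
  familyMin (π.parts.image Finset.val)

/-- The set of (values of) left-to-right minima of a permutation of `[N]`; the element `i` of
`Fin N` stands for `i + 1`. -/
def lmin {N : ℕ} (σ : Equiv.Perm (Fin N)) : Set ℕ :=
  {v | ∃ p, v = (σ p).val + 1 ∧ ∀ q < p, σ p < σ q}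

/-- The multiset `{1^e, …, N^e}`. -/
def fullMultiset (e N : ℕ) : Multiset ℕ :=
  ∑ a ∈ Finset.Icc 1 N, Multiset.replicate e a

/-- The pairs `(π₀, π₁)` counted by the numbers of the second kind. -/
structure IsPartitionPair (k N r : ℕ) (π₀ : Finset (Multiset ℕ))
    (π₁ : Finpartition (Finset.Icc 1 N)) : Prop where
  /-- `π₁` has `r` blocks. -/
  card_parts : π₁.parts.card = r
  /-- `π₀` has `r` blocks, all of them nonempty. -/
  card_family : π₀.card = r
  nonempty : ∀ B ∈ π₀, B ≠ 0
  segmented : IsSegmented (Set.Icc 1 (N + 1)) π₀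
  /-- The elements of `π₀` form a multi-subset of `{1^(k-2), …, (N+1)^(k-2)}`. -/
  sub : familySum π₀ ≤ fullMultiset (k - 2) (N + 1)
  /-- A minimal element of a block of `π₀` occurs exactly once in `π₀`. -/
  min_once : ∀ p ∈ familyMin π₀, (familySum π₀).count p = 1
  min_eq : partitionMin π₁ = familyMin π₀
  /-- All `k - 2` copies of the first non-minimum are in the block of `1`. -/
  first_nonmin : ∀ x, IsLeast (Set.Icc 1 N \ partitionMin π₁) x →
    ∃ B ∈ π₀, 1 ∈ B ∧ B.count x = k - 2

/-- The pairs `(σ₀, σ₁)` counted by the numbers of the first kind. -/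
structure IsPermutationPair (k N : ℕ) (r : ℤ) (σ₀ : Finset (Multiset ℕ))
    (σ₁ : Equiv.Perm (Fin N)) : Prop where
  /-- `σ₁` has `r` left-to-right minima. -/
  card_lmin : ((lmin σ₁).ncard : ℤ) = r
  /-- `σ₀` has `r` blocks, all of them nonempty. -/
  card_family : (σ₀.card : ℤ) = r
  nonempty : ∀ B ∈ σ₀, B ≠ 0
  segmented : IsSegmented (Set.Icc 1 (N + 1)) σ₀
  /-- The elements of `σ₀` are those of `[N + 1]`; a minimal element of a block occurs exactly
  once in `σ₀`, and every other element exactly `k - 2` times. -/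
  mem_iff : ∀ a, a ∈ familySum σ₀ ↔ a ∈ Set.Icc 1 (N + 1)
  min_once : ∀ p ∈ familyMin σ₀, (familySum σ₀).count p = 1
  nonmin_count : ∀ a ∈ Set.Icc 1 (N + 1), a ∉ familyMin σ₀ → (familySum σ₀).count a = k - 2
  min_eq : lmin σ₁ = familyMin σ₀
  /-- All `k - 2` copies of the first non-minimum are in the block of `1`. -/
  first_nonmin : ∀ x, IsLeast (Set.Icc 1 N \ lmin σ₁) x → ∃ B ∈ σ₀, 1 ∈ B ∧ B.count x = k - 2
  /-- Apart from the copies of the first non-minimum, no element is repeated within a block. -/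
  no_repeat : ∀ y, ¬ IsLeast (Set.Icc 1 N \ lmin σ₁) y → ∀ B ∈ σ₀, B.count y ≤ 1

/-- The pairs `(π₀, π₁)` for `[N]` with `r` blocks. -/
def partitionPairs (k N r : ℕ) :
    Set (Finset (Multiset ℕ) × Finpartition (Finset.Icc 1 N)) :=
  {q | IsPartitionPair k N r q.1 q.2}

/-- The pairs `(σ₀, σ₁)` for `[N]` with `r` left-to-right minima. -/
def permutationPairs (k N : ℕ) (r : ℤ) :
    Set (Finset (Multiset ℕ) × Equiv.Perm (Fin N)) :=
  {q | IsPermutationPair k N r q.1 q.2}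

/-- Used to see that the sets of pairs are finite, so that the cardinalities below are meaningful. -/
theorem finite_families (M : Multiset ℕ) :
    {F : Finset (Multiset ℕ) | familySum F ≤ M}.Finite := by
  refine (M.powerset.toFinset.powerset.finite_toSet).subset ?_
  intro F hF
  simp only [Finset.coe_powerset, Set.mem_preimage, Set.mem_powerset_iff]
  intro B hB
  simp only [Finset.mem_coe, Multiset.mem_toFinset, Multiset.mem_powerset]
  exact (Finset.single_le_sum (f := fun B : Multiset ℕ => B)
    (fun _ _ => Multiset.zero_le _) hB).trans hF

theorem partitionPairs_finite (k N r : ℕ) : (partitionPairs k N r).Finite :=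
  ((finite_families (fullMultiset (k - 2) (N + 1))).prod Set.finite_univ).subset
    fun _ hq => ⟨hq.sub, Set.mem_univ _⟩

theorem permutationPairs_finite (k N : ℕ) (r : ℤ) : (permutationPairs k N r).Finite := by
  refine ((finite_families (fullMultiset (k - 2 + 1) (N + 1))).prod Set.finite_univ).subset ?_
  intro q hq
  refine ⟨?_, Set.mem_univ _⟩
  rw [Set.mem_ofPred_eq, Multiset.le_iff_count]
  intro a
  by_cases ha : a ∈ Set.Icc 1 (N + 1)
  · have h1 : (fullMultiset (k - 2 + 1) (N + 1)).count a = k - 2 + 1 := by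
      simp only [Set.mem_Icc] at ha
      simp only [fullMultiset, Multiset.count_sum', Multiset.count_replicate,
        Finset.sum_ite_eq', Finset.mem_Icc]
      rw [if_pos ha]
    rw [h1]
    by_cases hm : a ∈ familyMin q.1
    · rw [hq.min_once a hm]; omega
    · rw [hq.nonmin_count a ha hm]; omega
  · rw [Multiset.count_eq_zero_of_notMem (fun h => ha ((hq.mem_iff a).1 h))]
    exact Nat.zero_le _

/-- The number of the second kind: the number of pairs `(π₀, π₁)` for `[N]` with `r` blocks. -/
noncomputable def secondKind (k N r : ℕ) : ℕ :=
  (partitionPairs k N r).ncard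

/-- The number of the first kind: the number of pairs `(σ₀, σ₁)` for `[N]` with `r` left-to-right
minima (zero for negative `r`). -/
noncomputable def firstKind (k N : ℕ) (r : ℤ) : ℕ :=
  (permutationPairs k N r).ncard

/-! Both sides satisfy the same recursion in `n`, obtained by removing the largest letter on one
side and the largest non-minimum on the other.

Pairs. Let `D` be the set of the `n` elements of `[N]` that are not minima. Given `D`, the two
components of a pair are independent. A family with minima `[N] \ D` is determined by saying, for
each `x` in `D ∪ {N + 1}`, into which blocks the copies of `x` go, a block being named by its
minimum. Segmentation says exactly that these minima lie between the preceding element of `D` and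
`x`, that is, in `gapBelow D x`. The choices for different `x` are independent, so the number of
families is a product of weights of gap sizes: multisets of size at most `k - 2` for the second
kind, subsets of size `k - 2` for the first, and weight one for the first element of `D`, whose
copies are forced. The partitions with minima `[N] \ D` number the product over `x ∈ D` of the
number of minima below `x`; the permutations with these left-to-right minima number the product of
the `x - 1`. Removing the maximum `x` of `D` splits off the gap of size `N - x` below `N + 1` and
lets `x` take over the role of the top element for `[x - 1]` (`gapProd_insert`, `sum_mul_gapProd`).
The result is a convolution recursion.

Words. In a Stirling permutation the `k` copies of the largest letter are contiguous. Inserting them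
at a descent or at the end of a nonempty word preserves the number of descents; any other position
raises it by one (`sum_insertBlock`). The descent polynomial therefore obeys a first-order
differential recursion, and division by the power of `1 - x` turns it into `Q ↦ x Q' / (1 -
x)^(k-1)`; for the reversed polynomial it becomes `Q ↦ x^k Q' / (1 - x)^(k-1)`. The coefficients of
these products are the convolutions found for the pairs (`partitionSum_eq_coeff`,
`permutationSum_succ_eq_coeff`). -/

/-! ### Segmented families with prescribed minima -/

/-- The minima available to the copies of `x` in a segmented family whose non-minima below `x` are
the elements of `D` below `x`. -/
def gapBelow (D : Finset ℕ) (x : ℕ) : Finset ℕ :=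
  (Finset.Ico 1 x).filter fun a => ∀ y ∈ D, y < x → y < a

theorem mem_gapBelow {D : Finset ℕ} {x a : ℕ} :
    a ∈ gapBelow D x ↔ (1 ≤ a ∧ a < x) ∧ ∀ y ∈ D, y < x → y < a := by
  simp [gapBelow]

/-- The families with minima `[N] \ D`. -/
structure IsMinFamily (N : ℕ) (D : Finset ℕ) (F : Finset (Multiset ℕ)) : Prop where
  ground : ∀ B ∈ F, ∀ y ∈ B, y ∈ Set.Icc 1 (N + 1)
  nonempty : ∀ B ∈ F, B ≠ 0
  segmented : IsSegmented (Set.Icc 1 (N + 1)) F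
  min_once : ∀ p ∈ familyMin F, (familySum F).count p = 1
  min_eq : familyMin F = ↑(Finset.Icc 1 N \ D)

/-- The least element of a multiset of natural numbers. -/
noncomputable def blockMin (B : Multiset ℕ) : ℕ :=
  sInf {y | y ∈ B}

/-- The multiset of the minima of the members containing `x`, with the multiplicities of `x`. -/
noncomputable def minimaOver (F : Finset (Multiset ℕ)) (x : ℕ) : Multiset ℕ :=
  ∑ B ∈ F, Multiset.replicate (B.count x) (blockMin B)

/-- The block with minimum `a` that contains `x ∈ E` as often as `h x` contains `a`. -/
def blockOf (E : Finset ℕ) (h : ℕ → Multiset ℕ) (a : ℕ) : Multiset ℕ :=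
  a ::ₘ ∑ x ∈ E, Multiset.replicate ((h x).count a) x

theorem isLeast_blockMin {B : Multiset ℕ} (hB : B ≠ 0) : IsLeast {y | y ∈ B} (blockMin B) :=
  ⟨Nat.sInf_mem (Multiset.exists_mem_of_ne_zero hB), fun _ hy => Nat.sInf_le hy⟩

theorem blockMin_eq {B : Multiset ℕ} {a : ℕ} (h : IsLeast {y | y ∈ B} a) : blockMin B = a :=
  h.csInf_eq

theorem count_familySum (F : Finset (Multiset ℕ)) (x : ℕ) :
    (familySum F).count x = ∑ B ∈ F, B.count x := by
  simp [familySum, Multiset.count_sum']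

theorem card_minimaOver (F : Finset (Multiset ℕ)) (x : ℕ) :
    (minimaOver F x).card = (familySum F).count x := by
  simp [minimaOver, count_familySum]

theorem count_blockOf (E : Finset ℕ) (h : ℕ → Multiset ℕ) (a y : ℕ) :
    (blockOf E h a).count y = (if y = a then 1 else 0) + if y ∈ E then (h y).count a else 0 := by
  simp only [blockOf, Multiset.count_cons, Multiset.count_sum', Multiset.count_replicate,
    Finset.sum_ite_eq']
  rw [add_comm]

theorem mem_minimaOver {F : Finset (Multiset ℕ)} {x a : ℕ} :
    a ∈ minimaOver F x ↔ ∃ B ∈ F, x ∈ B ∧ a = blockMin B := by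
  simp only [minimaOver, Multiset.mem_sum, Multiset.mem_replicate, Multiset.count_ne_zero]

namespace IsMinFamily

variable {N : ℕ} {D : Finset ℕ} {F : Finset (Multiset ℕ)}

theorem blockMin_mem (hF : IsMinFamily N D F) {B : Multiset ℕ} (hB : B ∈ F) :
    blockMin B ∈ Finset.Icc 1 N \ D := by
  have : blockMin B ∈ familyMin F := ⟨B, hB, isLeast_blockMin (hF.nonempty B hB)⟩
  rwa [hF.min_eq, Finset.mem_coe] at this

theorem eq_of_mem (hF : IsMinFamily N D F) {a : ℕ} (ha : a ∈ familyMin F) {B C : Multiset ℕ}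
    (hB : B ∈ F) (hC : C ∈ F) (haB : a ∈ B) (haC : a ∈ C) : B = C := by
  by_contra hne
  have h1 := hF.min_once a ha
  rw [count_familySum] at h1
  have h2 : ∑ B' ∈ {B, C}, B'.count a ≤ ∑ B' ∈ F, B'.count a :=
    Finset.sum_le_sum_of_subset (by simp [Finset.insert_subset_iff, hB, hC])
  rw [Finset.sum_pair hne] at h2
  have := Multiset.count_pos.2 haB
  have := Multiset.count_pos.2 haC
  omega

theorem blockMin_injOn (hF : IsMinFamily N D F) : Set.InjOn blockMin (F : Set (Multiset ℕ)) := by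
  intro B hB C hC h
  have hB' := isLeast_blockMin (hF.nonempty B hB)
  have hC' := isLeast_blockMin (hF.nonempty C hC)
  exact hF.eq_of_mem ⟨B, hB, hB'⟩ hB hC hB'.1 (h ▸ hC'.1)

theorem image_blockMin (hF : IsMinFamily N D F) : F.image blockMin = Finset.Icc 1 N \ D := by
  ext a
  rw [← Finset.mem_coe (s := Finset.Icc 1 N \ D), ← hF.min_eq]
  simp only [Finset.mem_image, familyMin, Set.mem_ofPred_eq]
  constructor
  · rintro ⟨B, hB, rfl⟩
    exact ⟨B, hB, isLeast_blockMin (hF.nonempty B hB)⟩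
  · rintro ⟨B, hB, h⟩
    exact ⟨B, hB, blockMin_eq h⟩

theorem card_eq (hF : IsMinFamily N D F) : F.card = (Finset.Icc 1 N \ D).card := by
  rw [← hF.image_blockMin, Finset.card_image_of_injOn hF.blockMin_injOn]

theorem count_minimaOver (hF : IsMinFamily N D F) {B : Multiset ℕ} (hB : B ∈ F) (x : ℕ) :
    (minimaOver F x).count (blockMin B) = B.count x := by
  simp only [minimaOver, Multiset.count_sum', Multiset.count_replicate]
  rw [Finset.sum_eq_single B]
  · simp
  · intro C hC hne
    rw [if_neg]
    exact fun h => hne (hF.blockMin_injOn hC hB h)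
  · exact fun h => (h hB).elim

/-- This is what segmentation gives: an element of `D` strictly between the minimum of a block and a
member `x` of that block would have to be a minimum, which elements of `D` are not. -/
theorem mem_gapBelow_of_mem (hF : IsMinFamily N D F) (hD : D ⊆ Finset.Icc 1 N) {x : ℕ}
    (hx : x ∈ insert (N + 1) D) : ∀ a ∈ minimaOver F x, a ∈ gapBelow D x := by
  intro a ha
  obtain ⟨B, hB, hxB, rfl⟩ := mem_minimaOver.1 ha
  have hm := hF.blockMin_mem hB
  have hl := isLeast_blockMin (hF.nonempty B hB)
  have hle : blockMin B ≤ x := hl.2 hxB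
  have hne : blockMin B ≠ x := by
    rintro rfl
    rw [Finset.mem_sdiff, Finset.mem_Icc] at hm
    rcases Finset.mem_insert.1 hx with h | h
    · omega
    · exact hm.2 h
  rw [Finset.mem_sdiff, Finset.mem_Icc] at hm
  refine mem_gapBelow.2 ⟨⟨hm.1.1, by omega⟩, fun y hy hyx => ?_⟩
  by_contra hlt
  have hya : blockMin B ≠ y := fun h => hm.2 (h ▸ hy)
  have hyN := Finset.mem_Icc.1 (hD hy)
  have := hF.segmented (blockMin B) ⟨hm.1.1, by omega⟩ y ⟨hyN.1, by omega⟩ x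
    (hF.ground B hB x hxB) (by omega) hyx ⟨B, hB, hl.1, hxB⟩
  rw [hF.min_eq] at this
  exact (Finset.mem_sdiff.1 (Finset.mem_coe.1 this)).2 hy

/-- An element outside `D ∪ {N + 1}` is the minimum of some block and occurs only once, so it lies
in `B` only as the minimum of `B`. All other multiplicities are recorded by `minimaOver`. -/
theorem blockOf_minimaOver (hF : IsMinFamily N D F) {B : Multiset ℕ} (hB : B ∈ F) :
    blockOf (insert (N + 1) D) (minimaOver F) (blockMin B) = B := by
  ext y
  rw [count_blockOf, hF.count_minimaOver hB]
  have hm := hF.blockMin_mem hB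
  have hl := isLeast_blockMin (hF.nonempty B hB)
  rw [Finset.mem_sdiff, Finset.mem_Icc] at hm
  by_cases hyE : y ∈ insert (N + 1) D
  · have : y ≠ blockMin B := by
      rintro rfl
      rcases Finset.mem_insert.1 hyE with h | h
      · omega
      · exact hm.2 h
    simp [hyE, this]
  · rw [if_neg hyE]
    by_cases hy : y = blockMin B
    · have h1 := hF.min_once y (hy ▸ ⟨B, hB, hl⟩)
      have h2 : B.count y ≤ (familySum F).count y := by
        rw [count_familySum]
        exact Finset.single_le_sum (f := fun B : Multiset ℕ => B.count y)
          (fun _ _ => Nat.zero_le _) hB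
      have h3 : 0 < B.count y := Multiset.count_pos.2 (hy ▸ hl.1)
      rw [if_pos hy]
      omega
    · rw [if_neg hy, eq_comm, Multiset.count_eq_zero]
      intro hyB
      have hyN := hF.ground B hB y hyB
      have hyM : y ∈ familyMin F := by
        rw [hF.min_eq]
        simp only [Finset.mem_insert, not_or] at hyE
        simp only [Finset.coe_sdiff, Set.mem_sdiff, Finset.mem_coe, Finset.mem_Icc]
        exact ⟨⟨hyN.1, by have := hyN.2; omega⟩, hyE.2⟩
      obtain ⟨C, hC, hyC⟩ := hyM
      have : B = C := hF.eq_of_mem ⟨C, hC, hyC⟩ hB hC hyB hyC.1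
      exact hy (blockMin_eq (this ▸ hyC)).symm

end IsMinFamily

/-- The family with blocks `blockOf (insert (N + 1) D) h a`, where `a ∈ [N] \ D`. -/
def familyOf (N : ℕ) (D : Finset ℕ) (h : ℕ → Multiset ℕ) : Finset (Multiset ℕ) :=
  (Finset.Icc 1 N \ D).image (blockOf (insert (N + 1) D) h)

section FamilyOf

variable {N : ℕ} {D : Finset ℕ} {h : ℕ → Multiset ℕ}

theorem isLeast_blockOf (hh : ∀ x ∈ insert (N + 1) D, ∀ a ∈ h x, a ∈ gapBelow D x) (a : ℕ) :
    IsLeast {y | y ∈ blockOf (insert (N + 1) D) h a} a := by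
  refine ⟨Multiset.mem_cons_self _ _, fun y hy => ?_⟩
  rw [Set.mem_ofPred_eq, ← Multiset.count_pos, count_blockOf] at hy
  by_cases hya : y = a
  · exact hya.ge
  · rw [if_neg hya] at hy
    by_cases hyE : y ∈ insert (N + 1) D
    · rw [if_pos hyE, zero_add, Multiset.count_pos] at hy
      exact (mem_gapBelow.1 (hh y hyE a hy)).1.2.le
    · simp [hyE] at hy

theorem blockOf_injective (hh : ∀ x ∈ insert (N + 1) D, ∀ a ∈ h x, a ∈ gapBelow D x) :
    Function.Injective (blockOf (insert (N + 1) D) h) := by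
  intro a b hab
  rw [← blockMin_eq (isLeast_blockOf hh a), hab, blockMin_eq (isLeast_blockOf hh b)]

theorem mem_sdiff_of_mem_gapBelow {x a : ℕ} (hD : D ⊆ Finset.Icc 1 N)
    (hx : x ∈ insert (N + 1) D) (ha : a ∈ gapBelow D x) : a ∈ Finset.Icc 1 N \ D := by
  rw [mem_gapBelow] at ha
  have hxN : x ≤ N + 1 := by
    rcases Finset.mem_insert.1 hx with h | h
    · omega
    · have := (Finset.mem_Icc.1 (hD h)).2; omega
  rw [Finset.mem_sdiff, Finset.mem_Icc]
  exact ⟨⟨ha.1.1, by omega⟩, fun h => lt_irrefl _ (ha.2 a h ha.1.2)⟩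

theorem minimaOver_familyOf (hD : D ⊆ Finset.Icc 1 N)
    (hh : ∀ x ∈ insert (N + 1) D, ∀ a ∈ h x, a ∈ gapBelow D x) {x : ℕ}
    (hx : x ∈ insert (N + 1) D) : minimaOver (familyOf N D h) x = h x := by
  ext a
  rw [minimaOver, familyOf, Finset.sum_image (blockOf_injective hh).injOn]
  simp only [fun a => blockMin_eq (isLeast_blockOf hh a), Multiset.count_sum',
    Multiset.count_replicate, Finset.sum_ite_eq']
  by_cases ha : a ∈ Finset.Icc 1 N \ D
  · rw [if_pos ha, count_blockOf, if_pos hx, if_neg, zero_add]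
    rintro rfl
    rw [Finset.mem_sdiff, Finset.mem_Icc] at ha
    rcases Finset.mem_insert.1 hx with h | h
    · omega
    · exact ha.2 h
  · rw [if_neg ha, eq_comm, Multiset.count_eq_zero]
    exact fun h' => ha (mem_sdiff_of_mem_gapBelow hD hx (hh x hx a h'))

theorem familyMin_familyOf (hh : ∀ x ∈ insert (N + 1) D, ∀ a ∈ h x, a ∈ gapBelow D x) :
    familyMin (familyOf N D h) = ↑(Finset.Icc 1 N \ D) := by
  ext a
  simp only [familyMin, familyOf, Finset.mem_image, Set.mem_ofPred_eq, Finset.mem_coe]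
  constructor
  · rintro ⟨B, ⟨b, hb, rfl⟩, hl⟩
    rwa [hl.unique (isLeast_blockOf hh b)]
  · exact fun ha => ⟨_, ⟨a, ha, rfl⟩, isLeast_blockOf hh a⟩

/-- For segmentation, let `a < b < c` with `a` and `c` in the block with minimum `e`. Then `e ≤ a <
b`, while `b ∈ D` would force `b < e`, because `e` lies in the gap below `c`. -/
theorem isMinFamily_familyOf (hD : D ⊆ Finset.Icc 1 N)
    (hh : ∀ x ∈ insert (N + 1) D, ∀ a ∈ h x, a ∈ gapBelow D x) :
    IsMinFamily N D (familyOf N D h) where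
  ground := by
    intro B hB y hy
    obtain ⟨a, ha, rfl⟩ := Finset.mem_image.1 hB
    rw [← Multiset.count_pos, count_blockOf] at hy
    rw [Finset.mem_sdiff, Finset.mem_Icc] at ha
    by_cases hya : y = a
    · rw [hya]; exact ⟨ha.1.1, by omega⟩
    · by_cases hyE : y ∈ insert (N + 1) D
      · rcases Finset.mem_insert.1 hyE with h | h
        · rw [h]; exact ⟨by omega, le_rfl⟩
        · have := Finset.mem_Icc.1 (hD h)
          exact ⟨this.1, by omega⟩
      · simp [hya, hyE] at hy
  nonempty := by
    intro B hB
    obtain ⟨a, -, rfl⟩ := Finset.mem_image.1 hB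
    exact Multiset.cons_ne_zero
  segmented := by
    rintro a - b hb c - hab hbc ⟨B, hB, haB, hcB⟩
    obtain ⟨e, -, rfl⟩ := Finset.mem_image.1 hB
    have hea : e ≤ a := (isLeast_blockOf hh e).2 haB
    rw [← Multiset.count_pos, count_blockOf, if_neg (by omega), zero_add] at hcB
    by_cases hcE : c ∈ insert (N + 1) D
    · rw [if_pos hcE, Multiset.count_pos] at hcB
      have hg := mem_gapBelow.1 (hh c hcE e hcB)
      have hcN : c ≤ N + 1 := by
        rcases Finset.mem_insert.1 hcE with h | h
        · omega
        · have := (Finset.mem_Icc.1 (hD h)).2; omega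
      rw [familyMin_familyOf hh, Finset.mem_coe, Finset.mem_sdiff, Finset.mem_Icc]
      refine ⟨⟨hb.1, by omega⟩, fun h => ?_⟩
      have := hg.2 b h hbc
      omega
    · simp [hcE] at hcB
  min_once := by
    intro p hp
    rw [familyMin_familyOf hh, Finset.mem_coe] at hp
    rw [count_familySum, familyOf, Finset.sum_image (blockOf_injective hh).injOn]
    have hpE : p ∉ insert (N + 1) D := by
      rw [Finset.mem_sdiff, Finset.mem_Icc] at hp
      rw [Finset.mem_insert]
      rintro (h | h)
      · omega
      · exact hp.2 h
    simp only [count_blockOf, if_neg hpE, add_zero, Finset.sum_ite_eq, if_pos hp]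
  min_eq := familyMin_familyOf hh

theorem familyOf_minimaOver {F : Finset (Multiset ℕ)} (hF : IsMinFamily N D F) :
    familyOf N D (minimaOver F) = F := by
  rw [familyOf, ← hF.image_blockMin, Finset.image_image]
  ext B
  simp only [Finset.mem_image, Function.comp]
  constructor
  · rintro ⟨C, hC, rfl⟩
    rwa [hF.blockOf_minimaOver hC]
  · exact fun hB => ⟨B, hB, hF.blockOf_minimaOver hB⟩

theorem familyOf_congr {h' : ℕ → Multiset ℕ} (H : ∀ x ∈ insert (N + 1) D, h x = h' x) :
    familyOf N D h = familyOf N D h' := by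
  have : blockOf (insert (N + 1) D) h = blockOf (insert (N + 1) D) h' := by
    funext a
    rw [blockOf, blockOf, Finset.sum_congr rfl fun x hx => by rw [H x hx]]
  rw [familyOf, familyOf, this]

end FamilyOf

/-- The families with minima `[N] \ D` in which the minima over each `x` are chosen from `opt x`. -/
noncomputable def familiesWith (N : ℕ) (D : Finset ℕ) (opt : ℕ → Finset (Multiset ℕ)) :
    Finset (Finset (Multiset ℕ)) :=
  ((insert (N + 1) D).finsupp opt).image fun h : ℕ →₀ Multiset ℕ => familyOf N D h

theorem mem_familiesWith {N : ℕ} {D : Finset ℕ} (hD : D ⊆ Finset.Icc 1 N)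
    {opt : ℕ → Finset (Multiset ℕ)}
    (hopt : ∀ x ∈ insert (N + 1) D, ∀ s ∈ opt x, ∀ a ∈ s, a ∈ gapBelow D x)
    {F : Finset (Multiset ℕ)} :
    F ∈ familiesWith N D opt ↔
      IsMinFamily N D F ∧ ∀ x ∈ insert (N + 1) D, minimaOver F x ∈ opt x := by
  classical
  simp only [familiesWith, Finset.mem_image, Finset.mem_finsupp_iff]
  constructor
  · rintro ⟨h, ⟨-, hm⟩, rfl⟩
    have hh : ∀ x ∈ insert (N + 1) D, ∀ a ∈ h x, a ∈ gapBelow D x :=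
      fun x hx => hopt x hx _ (hm x hx)
    refine ⟨isMinFamily_familyOf hD hh, fun x hx => ?_⟩
    rw [minimaOver_familyOf hD hh hx]
    exact hm x hx
  · rintro ⟨hF, hm⟩
    have key : ∀ x ∈ insert (N + 1) D,
        Finsupp.indicator (insert (N + 1) D) (fun x _ => minimaOver F x) x = minimaOver F x :=
      fun x hx => by rw [Finsupp.indicator_apply, dif_pos hx]
    refine ⟨Finsupp.indicator (insert (N + 1) D) fun x _ => minimaOver F x,
      ⟨Finsupp.support_indicator_subset _ _, fun x hx => ?_⟩, ?_⟩
    · rw [key x hx]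
      exact hm x hx
    · rw [familyOf_congr key, familyOf_minimaOver hF]

/-- The choices for different `x` are independent, and `minimaOver` recovers each of them from the
family. -/
theorem card_familiesWith {N : ℕ} {D : Finset ℕ} (hD : D ⊆ Finset.Icc 1 N)
    {opt : ℕ → Finset (Multiset ℕ)}
    (hopt : ∀ x ∈ insert (N + 1) D, ∀ s ∈ opt x, ∀ a ∈ s, a ∈ gapBelow D x) :
    (familiesWith N D opt).card = ∏ x ∈ insert (N + 1) D, (opt x).card := by
  rw [familiesWith, Finset.card_image_of_injOn, Finset.card_finsupp]
  intro h hh h' hh' heq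
  rw [Finset.mem_coe, Finset.mem_finsupp_iff] at hh hh'
  ext1 x
  by_cases hx : x ∈ insert (N + 1) D
  · rw [← minimaOver_familyOf hD (fun x hx => hopt x hx _ (hh.2 x hx)) hx,
      ← minimaOver_familyOf hD (fun x hx => hopt x hx _ (hh'.2 x hx)) hx]
    exact congrArg (minimaOver · x) heq
  · rw [Finsupp.notMem_support_iff.1 fun h1 => hx (hh.1 h1),
      Finsupp.notMem_support_iff.1 fun h1 => hx (hh'.1 h1)]

/-! ### Set partitions with prescribed minima -/

section Partitions

variable {N : ℕ} {D : Finset ℕ}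

/-- The least element of the block of `y`. -/
noncomputable def partRep (π : Finpartition (Finset.Icc 1 N)) (y : ℕ) : ℕ :=
  sInf {z | z ∈ π.part y}

theorem isLeast_partRep (π : Finpartition (Finset.Icc 1 N)) {y : ℕ} (hy : y ∈ Finset.Icc 1 N) :
    IsLeast {z | z ∈ π.part y} (partRep π y) :=
  ⟨Nat.sInf_mem ⟨y, π.mem_part_self.2 hy⟩, fun _ hz => Nat.sInf_le hz⟩

theorem partitionMin_eq_image (π : Finpartition (Finset.Icc 1 N)) :
    partitionMin π = partRep π '' Finset.Icc 1 N := by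
  ext a
  simp only [partitionMin, familyMin, Finset.mem_image, Set.mem_image, Set.mem_ofPred_eq,
    Finset.mem_coe]
  constructor
  · rintro ⟨_, ⟨t, ht, rfl⟩, hl⟩
    obtain ⟨y, hy⟩ := π.nonempty_of_mem_parts ht
    have hyN := π.subset ht hy
    have hp := isLeast_partRep π hyN
    rw [π.part_eq_of_mem ht hy] at hp
    exact ⟨y, hyN, hp.unique hl⟩
  · rintro ⟨y, hy, rfl⟩
    exact ⟨_, ⟨π.part y, π.part_mem.2 hy, rfl⟩, isLeast_partRep π hy⟩

theorem partRep_eq_iff (π : Finpartition (Finset.Icc 1 N)) {y z : ℕ} (hy : y ∈ Finset.Icc 1 N)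
    (hz : z ∈ Finset.Icc 1 N) : partRep π z = partRep π y ↔ z ∈ π.part y := by
  rw [π.mem_part_iff_part_eq_part hz hy]
  constructor
  · intro h
    have h1 := (isLeast_partRep π hz).1
    rw [h] at h1
    exact π.eq_of_mem_parts (π.part_mem.2 hz) (π.part_mem.2 hy) h1 (isLeast_partRep π hy).1
  · intro h
    rw [partRep, partRep, h]

theorem partRep_of_mem_partitionMin (π : Finpartition (Finset.Icc 1 N)) {y : ℕ}
    (hy : y ∈ partitionMin π) : partRep π y = y := by
  rw [partitionMin_eq_image] at hy
  obtain ⟨z, hz, rfl⟩ := hy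
  have h := (isLeast_partRep π hz).1
  exact (partRep_eq_iff π hz (π.part_subset _ h)).2 h

theorem finpartition_ext_of_partRep {π ρ : Finpartition (Finset.Icc 1 N)}
    (h : ∀ y ∈ Finset.Icc 1 N, partRep π y = partRep ρ y) : π = ρ := by
  have hpart : ∀ y ∈ Finset.Icc 1 N, π.part y = ρ.part y := by
    intro y hy
    ext z
    by_cases hz : z ∈ Finset.Icc 1 N
    · rw [← partRep_eq_iff π hy hz, ← partRep_eq_iff ρ hy hz, h y hy, h z hz]
    · exact ⟨fun h => (hz (π.part_subset _ h)).elim, fun h => (hz (ρ.part_subset _ h)).elim⟩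
  have key : ∀ {π ρ : Finpartition (Finset.Icc 1 N)},
      (∀ y ∈ Finset.Icc 1 N, π.part y = ρ.part y) → π.parts ⊆ ρ.parts := by
    intro π ρ hpart t ht
    obtain ⟨y, hy⟩ := π.nonempty_of_mem_parts ht
    have hyN := π.subset ht hy
    rw [← π.part_eq_of_mem ht hy, hpart y hyN]
    exact ρ.part_mem.2 hyN
  exact Finpartition.ext ((key hpart).antisymm (key fun y hy => (hpart y hy).symm))

/-- The partition into the fibres of `f` works: idempotence puts `f y` in the fibre of `y`, and `f z
≤ z` makes it the least element there. -/
theorem exists_partRep_eq (f : ℕ → ℕ) (hf : ∀ y ∈ Finset.Icc 1 N, f y ∈ Finset.Icc 1 N)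
    (hle : ∀ y ∈ Finset.Icc 1 N, f y ≤ y) (hff : ∀ y ∈ Finset.Icc 1 N, f (f y) = f y) :
    ∃ π : Finpartition (Finset.Icc 1 N), ∀ y ∈ Finset.Icc 1 N, partRep π y = f y := by
  classical
  refine ⟨Finpartition.ofSetSetoid (Setoid.ker f) _, fun y hy => ?_⟩
  refine IsLeast.csInf_eq ⟨?_, fun z hz => ?_⟩
  · rw [Set.mem_ofPred_eq, Finpartition.mem_part_ofSetSetoid_iff_rel]
    exact ⟨hy, hf y hy, (hff y hy).symm⟩
  · rw [Set.mem_ofPred_eq, Finpartition.mem_part_ofSetSetoid_iff_rel] at hz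
    have h : f y = f z := hz.2.2
    rw [h]
    exact hle z hz.2.1

open Classical in
/-- The number of partitions of `[N]` whose set of minima is `[N] \ D`. -/
theorem card_partitions (hD : D ⊆ Finset.Icc 1 N) :
    (Finset.univ.filter fun π : Finpartition (Finset.Icc 1 N) =>
      partitionMin π = ↑(Finset.Icc 1 N \ D)).card = ∏ x ∈ D, (Finset.Ico 1 x \ D).card := by
  rw [← Finset.card_finsupp D fun x => Finset.Ico 1 x \ D]
  have key : ∀ π : Finpartition (Finset.Icc 1 N), ∀ x ∈ D,
      Finsupp.indicator D (fun x _ => partRep π x) x = partRep π x :=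
    fun π x hx => by rw [Finsupp.indicator_apply, dif_pos hx]
  -- A partition is encoded by sending each non-minimum to the minimum of its block, which may be
  -- any smaller element outside `D`.
  refine Finset.card_bij (fun π _ => Finsupp.indicator D fun x _ => partRep π x) ?_ ?_ ?_
  · intro π hπ
    rw [Finset.mem_filter] at hπ
    rw [Finset.mem_finsupp_iff]
    refine ⟨Finsupp.support_indicator_subset _ _, fun x hx => ?_⟩
    rw [key π x hx]
    have h1 : partRep π x ∈ partitionMin π := by
      rw [partitionMin_eq_image]
      exact ⟨x, hD hx, rfl⟩
    have h2 : partRep π x ≤ x := (isLeast_partRep π (hD hx)).2 (π.mem_part_self.2 (hD hx))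
    rw [hπ.2, Finset.mem_coe, Finset.mem_sdiff, Finset.mem_Icc] at h1
    rw [Finset.mem_sdiff, Finset.mem_Ico]
    exact ⟨⟨h1.1.1, lt_of_le_of_ne h2 fun h => h1.2 (by rwa [h])⟩, h1.2⟩
  · intro π hπ ρ hρ h
    rw [Finset.mem_filter] at hπ hρ
    refine finpartition_ext_of_partRep fun y hy => ?_
    by_cases hyD : y ∈ D
    · rw [← key π y hyD, ← key ρ y hyD, h]
    · have hyM : y ∈ (↑(Finset.Icc 1 N \ D) : Set ℕ) :=
        Finset.mem_coe.2 (Finset.mem_sdiff.2 ⟨hy, hyD⟩)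
      rw [partRep_of_mem_partitionMin π (hπ.2 ▸ hyM), partRep_of_mem_partitionMin ρ (hρ.2 ▸ hyM)]
  · intro f hf
    rw [Finset.mem_finsupp_iff] at hf
    have hval : ∀ y ∈ D, (1 ≤ f y ∧ f y < y) ∧ f y ∉ D := fun y hy => by
      simpa using hf.2 y hy
    obtain ⟨π, hπ⟩ := exists_partRep_eq (N := N) (fun y => if y ∈ D then f y else y)
      (fun y hy => by
        by_cases h : y ∈ D
        · have := hval y h
          rw [Finset.mem_Icc] at hy
          rw [if_pos h, Finset.mem_Icc]
          omega
        · rwa [if_neg h])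
      (fun y hy => by
        by_cases h : y ∈ D
        · rw [if_pos h]; exact (hval y h).1.2.le
        · rw [if_neg h])
      (fun y hy => by
        by_cases h : y ∈ D
        · simp [h, (hval y h).2]
        · simp [h])
    refine ⟨π, ?_, ?_⟩
    · rw [Finset.mem_filter]
      refine ⟨Finset.mem_univ _, ?_⟩
      rw [partitionMin_eq_image, Set.image_congr hπ]
      ext a
      simp only [Set.mem_image, Finset.mem_coe, Finset.mem_sdiff]
      constructor
      · rintro ⟨y, hy, rfl⟩
        by_cases h : y ∈ D
        · have := hval y h
          rw [Finset.mem_Icc] at hy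
          rw [if_pos h, Finset.mem_Icc]
          exact ⟨by omega, this.2⟩
        · rw [if_neg h]
          exact ⟨hy, h⟩
      · rintro ⟨ha, haD⟩
        exact ⟨a, ha, if_neg haD⟩
    · ext x
      by_cases hx : x ∈ D
      · rw [key π x hx, hπ x (hD hx), if_pos hx]
      · rw [Finsupp.indicator_apply, dif_neg hx,
          Finsupp.notMem_support_iff.1 fun h => hx (hf.1 h)]

end Partitions

/-! ### Permutations with prescribed left-to-right minima -/

section Permutations

/-- The positions (from `1`) of the left-to-right minima of a permutation of `Fin N`. -/
def recordPositions {N : ℕ} (τ : Equiv.Perm (Fin N)) : Set ℕ :=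
  {v | ∃ i, v = i.val + 1 ∧ ∀ u < i, τ i < τ u}

/-- Being a left-to-right minimum means that no point of the graph lies to the lower left, a
condition symmetric in position and value. Positions are easier to handle by induction, since
appending a last value leaves the earlier ones unchanged. -/
theorem lmin_symm {N : ℕ} (τ : Equiv.Perm (Fin N)) : lmin τ.symm = recordPositions τ := by
  ext v
  constructor
  · rintro ⟨p, rfl, h⟩
    refine ⟨τ.symm p, rfl, fun u hu => ?_⟩
    rw [Equiv.apply_symm_apply]
    refine lt_of_le_of_ne (le_of_not_gt fun hlt => ?_) fun he => ?_
    · have := h _ hlt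
      rw [Equiv.symm_apply_apply] at this
      exact absurd hu this.asymm
    · rw [he, Equiv.symm_apply_apply] at hu
      exact lt_irrefl _ hu
  · rintro ⟨i, rfl, h⟩
    refine ⟨τ i, by rw [Equiv.symm_apply_apply], fun q hq => ?_⟩
    rw [Equiv.symm_apply_apply]
    refine lt_of_le_of_ne (le_of_not_gt fun hlt => ?_) fun he => ?_
    · have := h _ hlt
      rw [Equiv.apply_symm_apply] at this
      exact absurd hq this.asymm
    · rw [he, Equiv.apply_symm_apply] at hq
      exact lt_irrefl _ hq

/-- The permutation of `Fin (N + 1)` with last value `p` whose other values are in the same relative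
order as those of `ρ`. -/
def snocPerm {N : ℕ} (p : Fin (N + 1)) (ρ : Equiv.Perm (Fin N)) : Equiv.Perm (Fin (N + 1)) :=
  (finSuccEquiv' (Fin.last N)).trans ((Equiv.optionCongr ρ).trans (finSuccEquiv' p).symm)

theorem snocPerm_last {N : ℕ} (p : Fin (N + 1)) (ρ : Equiv.Perm (Fin N)) :
    snocPerm p ρ (Fin.last N) = p := by
  simp [snocPerm]

theorem snocPerm_castSucc {N : ℕ} (p : Fin (N + 1)) (ρ : Equiv.Perm (Fin N)) (i : Fin N) :
    snocPerm p ρ i.castSucc = p.succAbove (ρ i) := by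
  simp [snocPerm, finSuccEquiv'_last_apply_castSucc]

theorem snocPerm_bijective (N : ℕ) :
    Function.Bijective fun q : Fin (N + 1) × Equiv.Perm (Fin N) => snocPerm q.1 q.2 := by
  rw [Fintype.bijective_iff_injective_and_card]
  refine ⟨?_, by simp [Fintype.card_perm, Nat.factorial_succ]⟩
  rintro ⟨p, ρ⟩ ⟨p', ρ'⟩ h
  have hp : p = p' := by
    rw [← snocPerm_last p ρ, ← snocPerm_last p' ρ']
    exact congrArg (· (Fin.last N)) h
  subst hp
  have hρ : ρ = ρ' := by
    ext1 i
    apply Fin.succAbove_right_injective (p := p)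
    rw [← snocPerm_castSucc, ← snocPerm_castSucc]
    exact congrArg (· i.castSucc) h
  rw [hρ]

theorem recordPositions_subset {N : ℕ} (τ : Equiv.Perm (Fin N)) {v : ℕ}
    (hv : v ∈ recordPositions τ) : v ∈ Finset.Icc 1 N := by
  obtain ⟨i, rfl, -⟩ := hv
  rw [Finset.mem_Icc]
  omega

/-- `Fin.succAbove` is increasing, so the earlier records persist; the last position is a record
exactly when its value is the least one. -/
theorem mem_recordPositions_snocPerm {N : ℕ} (p : Fin (N + 1)) (ρ : Equiv.Perm (Fin N)) (v : ℕ) :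
    v ∈ recordPositions (snocPerm p ρ) ↔ v ∈ recordPositions ρ ∨ (v = N + 1 ∧ p = 0) := by
  constructor
  · rintro ⟨i, rfl, h⟩
    induction i using Fin.lastCases with
    | last =>
      right
      refine ⟨by simp, ?_⟩
      by_contra hp
      obtain ⟨j, hj⟩ := Fin.exists_succAbove_eq (Ne.symm hp)
      have := h (ρ.symm j).castSucc (Fin.castSucc_lt_last _)
      rw [snocPerm_last, snocPerm_castSucc, Equiv.apply_symm_apply, hj] at this
      exact absurd this (Fin.not_lt_zero _)
    | cast i =>
      left
      refine ⟨i, by simp, fun u hu => ?_⟩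
      have := h u.castSucc (by simpa using hu)
      rw [snocPerm_castSucc, snocPerm_castSucc] at this
      exact (Fin.strictMono_succAbove p).lt_iff_lt.1 this
  · rintro (⟨i, rfl, h⟩ | ⟨rfl, rfl⟩)
    · refine ⟨i.castSucc, by simp, fun u hu => ?_⟩
      induction u using Fin.lastCases with
      | last => exact absurd hu (Fin.castSucc_lt_last _).asymm
      | cast u =>
        rw [snocPerm_castSucc, snocPerm_castSucc]
        exact Fin.strictMono_succAbove p (h u (by simpa using hu))
    · refine ⟨Fin.last N, by simp, fun u hu => ?_⟩
      induction u using Fin.lastCases with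
      | last => exact absurd hu (lt_irrefl _)
      | cast u =>
        rw [snocPerm_last, snocPerm_castSucc, Fin.succAbove_zero]
        exact Fin.succ_pos _

open Classical in
theorem card_recordPositions (N : ℕ) {D : Finset ℕ} (hD : D ⊆ Finset.Icc 1 N) :
    (Finset.univ.filter fun τ : Equiv.Perm (Fin N) =>
      recordPositions τ = ↑(Finset.Icc 1 N \ D)).card = ∏ x ∈ D, (x - 1) := by
  induction N generalizing D with
  | zero =>
    have : D = ∅ := by simpa using hD
    subst this
    rw [Finset.prod_empty, Finset.card_eq_one]
    refine ⟨1, ?_⟩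
    ext τ
    simp only [Finset.mem_filter, Finset.mem_univ, true_and, Finset.mem_singleton]
    refine ⟨fun _ => Subsingleton.elim _ _, fun _ => ?_⟩
    ext v
    refine ⟨fun hv => ?_, fun hv => ?_⟩
    · simpa using recordPositions_subset τ hv
    · simp at hv
  | succ N ih =>
    have hcard : ∀ S : Finset (Equiv.Perm (Fin (N + 1))), S.card =
        (Finset.univ.filter fun q : Fin (N + 1) × Equiv.Perm (Fin N) =>
          snocPerm q.1 q.2 ∈ S).card := by
      intro S
      symm
      refine Finset.card_bij (fun q _ => snocPerm q.1 q.2) (fun q hq => (Finset.mem_filter.1 hq).2)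
        (fun q _ q' _ h => (snocPerm_bijective N).1 h) fun τ hτ => ?_
      obtain ⟨q, rfl⟩ := (snocPerm_bijective N).2 τ
      exact ⟨q, Finset.mem_filter.2 ⟨Finset.mem_univ _, hτ⟩, rfl⟩
    have hD' : D.erase (N + 1) ⊆ Finset.Icc 1 N := by
      intro x hx
      rw [Finset.mem_erase] at hx
      have := Finset.mem_Icc.1 (hD hx.2)
      rw [Finset.mem_Icc]
      omega
    have hiff : ∀ (p : Fin (N + 1)) (ρ : Equiv.Perm (Fin N)),
        recordPositions (snocPerm p ρ) = ↑(Finset.Icc 1 (N + 1) \ D) ↔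
          (p = 0 ↔ N + 1 ∉ D) ∧ recordPositions ρ = ↑(Finset.Icc 1 N \ D.erase (N + 1)) := by
      intro p ρ
      have hN : N + 1 ∉ recordPositions ρ := fun h => by
        have := recordPositions_subset ρ h
        simp at this
      simp only [Set.ext_iff, mem_recordPositions_snocPerm]
      constructor
      · intro h
        refine ⟨by simpa [hN] using h (N + 1), fun v => ?_⟩
        by_cases hv : v = N + 1
        · subst hv; simp [hN]
        · have := h v
          simp only [hv, false_and, or_false] at this
          rw [this]
          simp only [Finset.coe_sdiff, Set.mem_sdiff, Finset.mem_coe, Finset.mem_Icc,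
            Finset.mem_erase]
          have : v ≤ N + 1 ↔ v ≤ N := by omega
          simp [hv, this]
      · rintro ⟨h0, h⟩ v
        by_cases hv : v = N + 1
        · subst hv
          simp [hN, h0]
        · rw [h v]
          simp only [Finset.coe_sdiff, Set.mem_sdiff, Finset.mem_coe, Finset.mem_Icc,
            Finset.mem_erase]
          have : v ≤ N + 1 ↔ v ≤ N := by omega
          simp [hv, this]
    rw [hcard]
    have hprod : (Finset.univ.filter fun q : Fin (N + 1) × Equiv.Perm (Fin N) =>
        snocPerm q.1 q.2 ∈ Finset.univ.filter fun τ : Equiv.Perm (Fin (N + 1)) =>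
          recordPositions τ = ↑(Finset.Icc 1 (N + 1) \ D)) =
        (Finset.univ.filter fun p : Fin (N + 1) => p = 0 ↔ N + 1 ∉ D) ×ˢ
          (Finset.univ.filter fun ρ : Equiv.Perm (Fin N) =>
            recordPositions ρ = ↑(Finset.Icc 1 N \ D.erase (N + 1))) := by
      ext ⟨p, ρ⟩
      simp only [Finset.mem_filter, Finset.mem_univ, true_and, Finset.mem_product, hiff]
    rw [hprod, Finset.card_product, ih hD']
    -- If `N + 1 ∈ D`, the last value is any of the `N` nonzero ones, which gives the factor `(N +
    -- 1) - 1`; otherwise it must be `0`.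
    by_cases hmem : N + 1 ∈ D
    · rw [← Finset.mul_prod_erase D _ hmem]
      simp only [hmem, not_true, iff_false]
      rw [Finset.filter_not, Finset.filter_eq' , if_pos (Finset.mem_univ _), Finset.card_sdiff]
      simp
    · rw [Finset.erase_eq_of_notMem hmem]
      simp only [hmem, not_false_iff, iff_true]
      rw [Finset.filter_eq', if_pos (Finset.mem_univ _), Finset.card_singleton, one_mul]

open Classical in
/-- The number of permutations of `[N]` whose set of left-to-right minima is `[N] \ D`. -/
theorem card_permutations {N : ℕ} {D : Finset ℕ} (hD : D ⊆ Finset.Icc 1 N) :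
    (Finset.univ.filter fun σ : Equiv.Perm (Fin N) =>
      lmin σ = ↑(Finset.Icc 1 N \ D)).card = ∏ x ∈ D, (x - 1) := by
  rw [← card_recordPositions N hD]
  refine Finset.card_bij (fun σ _ => σ.symm) ?_ (fun σ _ τ _ h => ?_) fun τ hτ => ?_
  · intro σ hσ
    rw [Finset.mem_filter] at hσ ⊢
    exact ⟨Finset.mem_univ _, by rw [← lmin_symm, Equiv.symm_symm, hσ.2]⟩
  · simpa using congrArg Equiv.symm h
  · rw [Finset.mem_filter] at hτ
    exact ⟨τ.symm, Finset.mem_filter.2 ⟨Finset.mem_univ _, by rw [lmin_symm, hτ.2]⟩,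
      Equiv.symm_symm _⟩

end Permutations

/-! ### Sums over the set of non-minima, by removal of its maximum -/

section Sums

/-- Splitting off the maximum of a subset of `[N]`. -/
theorem sum_powersetCard_Icc {M : Type*} [AddCommMonoid M] (n N : ℕ) (f : Finset ℕ → M) :
    ∑ D ∈ (Finset.Icc 1 N).powersetCard (n + 1), f D =
      ∑ x ∈ Finset.Icc 1 N, ∑ D ∈ (Finset.Icc 1 (x - 1)).powersetCard n, f (insert x D) := by
  induction N with
  | zero => 
    rw [Finset.powersetCard_eq_empty.2 (by simp)]
    simp
  | succ N ih =>
    have hN : N + 1 ∉ Finset.Icc 1 N := by simp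
    have hI : Finset.Icc 1 (N + 1) = insert (N + 1) (Finset.Icc 1 N) :=
      (Finset.insert_Icc_right_eq_Icc_add_one (by omega)).symm
    have hsub : ∀ D ∈ (Finset.Icc 1 N).powersetCard n, N + 1 ∉ D := fun D hD h =>
      hN ((Finset.mem_powersetCard.1 hD).1 h)
    rw [hI, Finset.powersetCard_succ_insert hN, Finset.sum_union, Finset.sum_insert hN, ih,
      add_comm, Finset.sum_image]
    · simp
    · intro D hD D' hD' h
      rw [← Finset.erase_insert (hsub D hD), ← Finset.erase_insert (hsub D' hD')]
      exact congrArg (Finset.erase · (N + 1)) h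
    · rw [Finset.disjoint_left]
      intro D hD hD'
      obtain ⟨D', -, rfl⟩ := Finset.mem_image.1 hD'
      exact hN ((Finset.mem_powersetCard.1 hD).1 (Finset.mem_insert_self _ _))

open Classical in
/-- The product of the weights `c` of the gaps below the elements of `D ∪ {N + 1}` other than the
first one. -/
noncomputable def gapProd (c : ℕ → ℕ) (N : ℕ) (D : Finset ℕ) : ℕ :=
  if D = ∅ then 1 else
    ∏ x ∈ insert (N + 1) D, if IsLeast (D : Set ℕ) x then 1 else c (gapBelow D x).card

theorem gapBelow_insert_last {x N : ℕ} (hx : 1 ≤ x) (hxN : x ≤ N) {D : Finset ℕ}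
    (hD : D ⊆ Finset.Icc 1 (x - 1)) : gapBelow (insert x D) (N + 1) = Finset.Ioc x N := by
  ext a
  rw [mem_gapBelow, Finset.mem_Ioc]
  constructor
  · rintro ⟨h, h'⟩
    exact ⟨h' x (Finset.mem_insert_self _ _) (by omega), by omega⟩
  · rintro ⟨h, h'⟩
    refine ⟨by omega, fun y hy _ => ?_⟩
    rcases Finset.mem_insert.1 hy with rfl | hy
    · exact h
    · have := Finset.mem_Icc.1 (hD hy)
      omega

theorem gapBelow_insert_of_le {x y : ℕ} (h : y ≤ x) (D : Finset ℕ) :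
    gapBelow (insert x D) y = gapBelow D y := by
  ext a
  simp only [mem_gapBelow, Finset.mem_insert, forall_eq_or_imp]
  refine and_congr_right fun _ => ⟨fun h' => h'.2, fun h' => ⟨fun h'' => ?_, h'⟩⟩
  omega

theorem isLeast_insert_iff {x : ℕ} {D : Finset ℕ} (hne : D.Nonempty)
    (hD : ∀ y ∈ D, y < x) (y : ℕ) :
    IsLeast ((insert x D : Finset ℕ) : Set ℕ) y ↔ IsLeast (D : Set ℕ) y := by
  obtain ⟨z, hz⟩ := hne
  have hzx := hD z hz
  simp only [IsLeast, lowerBounds, Finset.coe_insert, Set.mem_insert_iff, Finset.mem_coe,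
    Set.mem_ofPred_eq, forall_eq_or_imp]
  constructor
  · rintro ⟨h1, -, h2⟩
    refine ⟨?_, h2⟩
    rcases h1 with rfl | h1
    · exact absurd (h2 z hz) hzx.not_ge
    · exact h1
  · rintro ⟨h1, h2⟩
    exact ⟨Or.inr h1, (hD y h1).le, h2⟩

/-- The gap below `N + 1` is `(x, N]`, and the remaining factors are those of `D` in `[x - 1]`, with
`x` as the top element. If `D` is empty, `x` is the first non-minimum and has weight one, which
explains the value of `gapProd` at the empty set. -/
theorem gapProd_insert (c : ℕ → ℕ) {x N : ℕ} (hx : 1 ≤ x) (hxN : x ≤ N) {D : Finset ℕ}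
    (hD : D ⊆ Finset.Icc 1 (x - 1)) :
    gapProd c N (insert x D) = gapProd c (x - 1) D * c (N - x) := by
  classical
  have hlt : ∀ y ∈ D, y < x := fun y hy => by have := Finset.mem_Icc.1 (hD hy); omega
  have hlast : N + 1 ∉ insert x D := by
    rw [Finset.mem_insert]
    rintro (h | h)
    · omega
    · have := hlt _ h; omega
  have hnl : ¬ IsLeast ((insert x D : Finset ℕ) : Set ℕ) (N + 1) := fun h => hlast h.1
  rw [gapProd, if_neg (Finset.insert_ne_empty _ _), Finset.prod_insert hlast, if_neg hnl,
    gapBelow_insert_last hx hxN hD, Nat.card_Ioc, mul_comm]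
  congr 1
  rcases D.eq_empty_or_nonempty with rfl | hne
  · simp [gapProd]
  · rw [gapProd, if_neg hne.ne_empty, Nat.sub_add_cancel hx]
    refine Finset.prod_congr rfl fun y hy => ?_
    have hyx : y ≤ x := by
      rcases Finset.mem_insert.1 hy with rfl | h
      · exact le_rfl
      · exact (hlt y h).le
    rw [gapBelow_insert_of_le hyx]
    simp only [isLeast_insert_iff hne hlt]

/-- If `u` is multiplicative along the removal of maxima, the sums of `u D * gapProd c N D` satisfy
a recursion. -/
theorem sum_mul_gapProd (c : ℕ → ℕ) (u : Finset ℕ → ℕ) (v : ℕ → ℕ → ℕ)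
    (huv : ∀ x D, D ⊆ Finset.Icc 1 (x - 1) → 1 ≤ x → u (insert x D) = u D * v x D.card)
    (n N : ℕ) :
    ∑ D ∈ (Finset.Icc 1 N).powersetCard (n + 1), u D * gapProd c N D =
      ∑ x ∈ Finset.Icc 1 N, (∑ D ∈ (Finset.Icc 1 (x - 1)).powersetCard n,
        u D * gapProd c (x - 1) D) * (v x n * c (N - x)) := by
  rw [sum_powersetCard_Icc]
  refine Finset.sum_congr rfl fun x hx => ?_
  rw [Finset.mem_Icc] at hx
  rw [Finset.sum_mul]
  refine Finset.sum_congr rfl fun D hD => ?_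
  rw [Finset.mem_powersetCard] at hD
  rw [gapProd_insert c hx.1 hx.2 hD.1, huv x D hD.1 hx.1, hD.2]
  ring

theorem prod_card_Ico_sdiff_insert (x : ℕ) (D : Finset ℕ) (hD : D ⊆ Finset.Icc 1 (x - 1))
    (hx : 1 ≤ x) :
    ∏ y ∈ insert x D, (Finset.Ico 1 y \ insert x D).card =
      (∏ y ∈ D, (Finset.Ico 1 y \ D).card) * (x - 1 - D.card) := by
  have hlt : ∀ y ∈ D, 1 ≤ y ∧ y < x := fun y hy => by
    have := Finset.mem_Icc.1 (hD hy); omega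
  have hsd : ∀ y ≤ x, Finset.Ico 1 y \ insert x D = Finset.Ico 1 y \ D := by
    intro y hy
    ext a
    simp only [Finset.mem_sdiff, Finset.mem_Ico, Finset.mem_insert, not_or]
    refine and_congr_right fun h => ⟨fun h' => h'.2, fun h' => ⟨by omega, h'⟩⟩
  rw [Finset.prod_insert fun h => lt_irrefl _ (hlt x h).2, hsd x le_rfl, mul_comm,
    Finset.card_sdiff_of_subset, Nat.card_Ico]
  · rw [Finset.prod_congr rfl fun y hy => by rw [hsd y (hlt y hy).2.le]]
  · exact fun y hy => Finset.mem_Ico.2 (hlt y hy)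

theorem prod_sub_one_insert (x : ℕ) (D : Finset ℕ) (hD : D ⊆ Finset.Icc 1 (x - 1))
    (hx : 1 ≤ x) : ∏ y ∈ insert x D, (y - 1) = (∏ y ∈ D, (y - 1)) * (x - 1) := by
  have : x ∉ D := fun h => by have := Finset.mem_Icc.1 (hD h); omega
  rw [Finset.prod_insert this, mul_comm]

end Sums

/-! ### Admissible distributions of the copies of one element -/

section Options

/-- The multisets with elements in `s` of cardinality at most `e`. -/
noncomputable def boundedMultisets (s : Finset ℕ) (e : ℕ) : Finset (Multiset ℕ) :=
  (Finset.range (e + 1)).biUnion fun j => (s.finsuppAntidiag j).image Finsupp.toMultiset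

theorem mem_image_finsuppAntidiag {s : Finset ℕ} {j : ℕ} {t : Multiset ℕ} :
    t ∈ (s.finsuppAntidiag j).image Finsupp.toMultiset ↔ (∀ a ∈ t, a ∈ s) ∧ t.card = j := by
  simp only [Finset.mem_image, Finset.mem_finsuppAntidiag']
  constructor
  · rintro ⟨f, ⟨h1, h2⟩, rfl⟩
    refine ⟨fun a ha => h2 ((Finsupp.mem_toMultiset _ _).1 ha), ?_⟩
    rw [Finsupp.card_toMultiset, ← h1]
    rfl
  · rintro ⟨h1, h2⟩
    refine ⟨Multiset.toFinsupp t, ⟨?_, fun a ha => ?_⟩, Multiset.toFinsupp_toMultiset t⟩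
    · rw [← h2, ← Multiset.toFinsupp_sum_eq]
      rfl
    · rw [Multiset.toFinsupp_support, Multiset.mem_toFinset] at ha
      exact h1 a ha

theorem mem_boundedMultisets {s : Finset ℕ} {e : ℕ} {t : Multiset ℕ} :
    t ∈ boundedMultisets s e ↔ (∀ a ∈ t, a ∈ s) ∧ t.card ≤ e := by
  simp only [boundedMultisets, Finset.mem_biUnion, mem_image_finsuppAntidiag, Finset.mem_range,
    Nat.lt_succ_iff]
  constructor
  · rintro ⟨j, hj, h, rfl⟩
    exact ⟨h, hj⟩
  · rintro ⟨h, hj⟩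
    exact ⟨_, hj, h, rfl⟩

/-- One extra element absorbs the unused copies, so multisets of size at most `e` are counted like
multisets of size exactly `e` on `s.card + 1` elements; the induction is Pascal's rule for
`multichoose`. -/
theorem card_boundedMultisets (s : Finset ℕ) (e : ℕ) :
    (boundedMultisets s e).card = (s.card + e).choose e := by
  have hsum : ∀ e, ∑ j ∈ Finset.range (e + 1), s.card.multichoose j =
      (s.card + 1).multichoose e := by
    intro e
    induction e with
    | zero => simp
    | succ e ih => rw [Finset.sum_range_succ, ih, Nat.multichoose_succ_succ, add_comm]
  have hinj : Function.Injective (Finsupp.toMultiset : (ℕ →₀ ℕ) → Multiset ℕ) :=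
    (Multiset.toFinsupp (α := ℕ)).symm.injective
  rw [boundedMultisets, Finset.card_biUnion]
  · rw [Finset.sum_congr rfl fun j _ => by
      rw [Finset.card_image_of_injective _ hinj,
        Finset.card_finsuppAntidiag_nat_eq_multichoose], hsum, Nat.multichoose_eq]
    congr 1
    omega
  · intro i _ j _ hij
    rw [Function.onFun, Finset.disjoint_left]
    intro t hi hj
    rw [mem_image_finsuppAntidiag] at hi hj
    exact hij (hi.2.symm.trans hj.2)

open Classical in
/-- All copies of the first element of `D` go to the block of `1`; the copies of any other `x` are
distributed according to `f (gapBelow D x)`. -/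
noncomputable def optionsOf (e : ℕ) (f : Finset ℕ → Finset (Multiset ℕ)) (D : Finset ℕ) (x : ℕ) :
    Finset (Multiset ℕ) :=
  if IsLeast (D : Set ℕ) x then {Multiset.replicate e 1} else f (gapBelow D x)

/-- The forced choice is legitimate because no element of `D` precedes the first one, so its gap
starts at `1`; the gap contains `1` because `1 ∉ D`. -/
theorem mem_gapBelow_of_mem_optionsOf {e : ℕ} {f : Finset ℕ → Finset (Multiset ℕ)}
    (hf : ∀ g, ∀ s ∈ f g, ∀ a ∈ s, a ∈ g) {N : ℕ} {D : Finset ℕ} (hD : D ⊆ Finset.Icc 1 N)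
    (h1 : 1 ∉ D) : ∀ x ∈ insert (N + 1) D, ∀ s ∈ optionsOf e f D x, ∀ a ∈ s,
      a ∈ gapBelow D x := by
  intro x hx s hs a ha
  rw [optionsOf] at hs
  split_ifs at hs with hl
  · rw [Finset.mem_singleton] at hs
    rw [hs] at ha
    have hxD : x ∈ D := hl.1
    have hx1 : x ≠ 1 := fun h => h1 (h ▸ hxD)
    have := Finset.mem_Icc.1 (hD hxD)
    rw [Multiset.eq_of_mem_replicate ha, mem_gapBelow]
    refine ⟨by omega, fun y hy hyx => ?_⟩
    have := hl.2 hy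
    omega
  · exact hf _ s hs a ha

theorem card_familiesWith_optionsOf {e : ℕ} {f : Finset ℕ → Finset (Multiset ℕ)} {c : ℕ → ℕ}
    (hf : ∀ g, ∀ s ∈ f g, ∀ a ∈ s, a ∈ g) (hc : ∀ g, (f g).card = c g.card) {N : ℕ}
    {D : Finset ℕ} (hD : D ⊆ Finset.Icc 1 N) (h1 : 1 ∉ D) (hne : D.Nonempty) :
    (familiesWith N D (optionsOf e f D)).card = gapProd c N D := by
  rw [card_familiesWith hD (mem_gapBelow_of_mem_optionsOf hf hD h1), gapProd,
    if_neg hne.ne_empty]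
  refine Finset.prod_congr rfl fun x _ => ?_
  rw [optionsOf]
  split_ifs
  · rw [Finset.card_singleton]
  · rw [hc]

/-- The subsets of `g` of cardinality `e`, as multisets. -/
def subsetMultisets (g : Finset ℕ) (e : ℕ) : Finset (Multiset ℕ) :=
  (g.powersetCard e).image Finset.val

theorem mem_subsetMultisets {g : Finset ℕ} {e : ℕ} {t : Multiset ℕ} :
    t ∈ subsetMultisets g e ↔ (∀ a ∈ t, a ∈ g) ∧ t.card = e ∧ t.Nodup := by
  simp only [subsetMultisets, Finset.mem_image, Finset.mem_powersetCard]
  constructor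
  · rintro ⟨s, ⟨h1, h2⟩, rfl⟩
    exact ⟨fun a ha => h1 ha, h2, s.nodup⟩
  · rintro ⟨h1, h2, h3⟩
    exact ⟨⟨t, h3⟩, ⟨fun a ha => h1 a ha, h2⟩, rfl⟩

theorem card_subsetMultisets (g : Finset ℕ) (e : ℕ) :
    (subsetMultisets g e).card = g.card.choose e := by
  rw [subsetMultisets, Finset.card_image_of_injective _ Finset.val_injective,
    Finset.card_powersetCard]

end Options

/-! ### Counting the pairs by their set of non-minima -/

section Pairs

theorem icc_sdiff_eq_iff {N : ℕ} {D D' : Finset ℕ} (hD : D ⊆ Finset.Icc 1 N)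
    (hD' : D' ⊆ Finset.Icc 1 N)
    (h : ((Finset.Icc 1 N \ D : Finset ℕ) : Set ℕ) = ↑(Finset.Icc 1 N \ D')) : D = D' := by
  rw [Finset.coe_inj] at h
  rw [← Finset.sdiff_sdiff_eq_self hD, h, Finset.sdiff_sdiff_eq_self hD']

/-- Counting pairs whose two components have the same set of minima `[N] \ D`. -/
theorem ncard_pairs {α β : Type*} [Fintype β] [DecidableEq α] [DecidableEq β] (N n : ℕ)
    (S : Set (α × β)) (A : Finset ℕ → Finset α) (mins : β → Set ℕ)
    [∀ D : Finset ℕ, DecidablePred fun b => mins b = ↑(Finset.Icc 1 N \ D)]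
    (hS : ∀ a b, (a, b) ∈ S ↔ ∃ D ∈ (Finset.Icc 1 N).powersetCard n,
      a ∈ A D ∧ mins b = ↑(Finset.Icc 1 N \ D)) :
    S.ncard = ∑ D ∈ (Finset.Icc 1 N).powersetCard n,
      (A D).card * (Finset.univ.filter fun b => mins b = ↑(Finset.Icc 1 N \ D)).card := by
  have hS' : S = ↑(((Finset.Icc 1 N).powersetCard n).biUnion fun D =>
      A D ×ˢ Finset.univ.filter fun b => mins b = ↑(Finset.Icc 1 N \ D)) := by
    ext ⟨a, b⟩
    simp only [hS, Finset.coe_biUnion, Set.mem_iUnion, Finset.mem_coe, Finset.mem_product,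
      Finset.mem_filter, Finset.mem_univ, true_and, exists_prop]
  rw [hS', Set.ncard_coe_finset, Finset.card_biUnion]
  · simp only [Finset.card_product]
  · intro D hD D' hD' hne
    rw [Function.onFun, Finset.disjoint_left]
    rintro ⟨a, b⟩ h h'
    simp only [Finset.mem_product, Finset.mem_filter, Finset.mem_univ, true_and] at h h'
    exact hne (icc_sdiff_eq_iff (Finset.mem_powersetCard.1 hD).1 (Finset.mem_powersetCard.1 hD').1
      (h.2.symm.trans h'.2))

theorem count_fullMultiset (e N a : ℕ) :
    (fullMultiset e N).count a = if a ∈ Finset.Icc 1 N then e else 0 := by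
  simp only [fullMultiset, Multiset.count_sum', Multiset.count_replicate, Finset.sum_ite_eq']

theorem mem_familySum {F : Finset (Multiset ℕ)} {a : ℕ} :
    a ∈ familySum F ↔ ∃ B ∈ F, a ∈ B := by
  rw [familySum, Multiset.mem_sum]

theorem icc_sdiff_coe {N : ℕ} {D : Finset ℕ} (hD : D ⊆ Finset.Icc 1 N) :
    Set.Icc 1 N \ (↑(Finset.Icc 1 N \ D) : Set ℕ) = ↑D := by
  rw [← Finset.coe_Icc, ← Finset.coe_sdiff, Finset.sdiff_sdiff_eq_self hD]

theorem card_parts_eq {N : ℕ} {D : Finset ℕ} {π : Finpartition (Finset.Icc 1 N)}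
    (h : partitionMin π = ↑(Finset.Icc 1 N \ D)) : π.parts.card = (Finset.Icc 1 N \ D).card := by
  have hl : ∀ t ∈ π.parts, IsLeast {y | y ∈ t.val} (blockMin t.val) := fun t ht =>
    isLeast_blockMin fun h0 => π.ne_empty ht (Finset.val_eq_zero.1 h0)
  refine Finset.card_bij (fun t _ => blockMin t.val) ?_ ?_ ?_
  · intro t ht
    rw [← Finset.mem_coe, ← h]
    exact ⟨t.val, Finset.mem_image_of_mem _ ht, hl t ht⟩
  · intro t ht u hu htu
    have h1 := (hl t ht).1
    have h2 := (hl u hu).1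
    rw [← htu] at h2
    exact π.eq_of_mem_parts ht hu h1 h2
  · intro a ha
    rw [← Finset.mem_coe, ← h] at ha
    obtain ⟨B, hB, hl⟩ := ha
    obtain ⟨t, ht, rfl⟩ := Finset.mem_image.1 hB
    exact ⟨t, ht, blockMin_eq hl⟩

namespace IsMinFamily

variable {N : ℕ} {D : Finset ℕ} {F : Finset (Multiset ℕ)}

theorem mem_insert_of_notMem (hF : IsMinFamily N D F) {a : ℕ} (ha : a ∈ Set.Icc 1 (N + 1))
    (ha' : a ∉ familyMin F) : a ∈ insert (N + 1) D := by
  rw [hF.min_eq, Finset.mem_coe, Finset.mem_sdiff, Finset.mem_Icc, not_and_not_right] at ha'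
  rw [Finset.mem_insert]
  by_cases h : a = N + 1
  · exact Or.inl h
  · exact Or.inr (ha' ⟨ha.1, by have := ha.2; omega⟩)

/-- A block containing `1` has minimum `1` and contributes `e` ones; the bound on the total
multiplicity leaves room for nothing else. -/
theorem minimaOver_eq_replicate (hF : IsMinFamily N D F) {e x : ℕ} {B : Multiset ℕ}
    (hB : B ∈ F) (h1 : 1 ∈ B) (hx : B.count x = e) (hle : (familySum F).count x ≤ e) :
    minimaOver F x = Multiset.replicate e 1 := by
  have hb : blockMin B = 1 := blockMin_eq ⟨h1, fun y hy => (hF.ground B hB y hy).1⟩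
  have hc := hF.count_minimaOver hB x
  rw [hb, hx] at hc
  have hle' : Multiset.replicate e 1 ≤ minimaOver F x :=
    Multiset.le_count_iff_replicate_le.1 hc.ge
  refine (Multiset.eq_of_le_of_card_le hle' ?_).symm
  rwa [card_minimaOver, Multiset.card_replicate]

theorem exists_of_minimaOver_eq_replicate (hF : IsMinFamily N D F) {e x : ℕ} (he : 0 < e)
    (h : minimaOver F x = Multiset.replicate e 1) : ∃ B ∈ F, 1 ∈ B ∧ B.count x = e := by
  have h1 : 1 ∈ minimaOver F x := by
    rw [h, Multiset.mem_replicate]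
    exact ⟨he.ne', rfl⟩
  obtain ⟨B, hB, -, hb⟩ := mem_minimaOver.1 h1
  refine ⟨B, hB, ?_, ?_⟩
  · rw [hb]
    exact (isLeast_blockMin (hF.nonempty B hB)).1
  · rw [← hF.count_minimaOver hB, ← hb, h, Multiset.count_replicate_self]

end IsMinFamily

/-- `D` is the set of non-minima of `π₁`, and the multiplicity bound becomes a bound on the
cardinality of `minimaOver`. The condition `2 < k` lets minima occur once and makes `k - 2` copies
in the block of `1` an actual occurrence. -/
theorem isPartitionPair_iff {k N r n : ℕ} (hk : 2 < k) (hN : N = n + r)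
    (π₀ : Finset (Multiset ℕ)) (π₁ : Finpartition (Finset.Icc 1 N)) :
    IsPartitionPair k N r π₀ π₁ ↔ ∃ D ∈ (Finset.Icc 1 N).powersetCard n,
      (IsMinFamily N D π₀ ∧ ∀ x ∈ insert (N + 1) D, minimaOver π₀ x ∈
        optionsOf (k - 2) (boundedMultisets · (k - 2)) D x) ∧
      partitionMin π₁ = ↑(Finset.Icc 1 N \ D) := by
  classical
  constructor
  · intro h
    have hsub : partitionMin π₁ ⊆ Finset.Icc 1 N := by
      rw [partitionMin_eq_image]
      rintro _ ⟨y, hy, rfl⟩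
      exact π₁.part_subset _ (isLeast_partRep π₁ hy).1
    set D := (Finset.Icc 1 N).filter (· ∉ partitionMin π₁) with hDdef
    have hD : D ⊆ Finset.Icc 1 N := Finset.filter_subset _ _
    have hmin : partitionMin π₁ = ↑(Finset.Icc 1 N \ D) := by
      ext a
      simp only [hDdef, Finset.coe_sdiff, Finset.coe_filter, Set.mem_sdiff, Finset.mem_coe,
        Set.mem_ofPred_eq, not_and_not_right]
      exact ⟨fun ha => ⟨hsub ha, fun _ => ha⟩, fun ha => ha.2 ha.1⟩
    have hcount : ∀ a, (familySum π₀).count a ≤ if a ∈ Finset.Icc 1 (N + 1) then k - 2 else 0 := by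
      intro a
      rw [← count_fullMultiset]
      exact Multiset.le_iff_count.1 h.sub a
    have hle : ∀ a, (familySum π₀).count a ≤ k - 2 := fun a => (hcount a).trans (by
      split_ifs <;> omega)
    have hF : IsMinFamily N D π₀ :=
      { ground := fun B hB y hy => by
          have h1 := Multiset.count_pos.2 (mem_familySum.2 ⟨B, hB, hy⟩)
          have h2 := hcount y
          by_contra hy'
          rw [if_neg (by simpa using hy')] at h2
          omega
        nonempty := h.nonempty
        segmented := h.segmented
        min_once := h.min_once
        min_eq := h.min_eq.symm.trans hmin }
    refine ⟨D, Finset.mem_powersetCard.2 ⟨hD, ?_⟩, ⟨hF, fun x hx => ?_⟩, hmin⟩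
    · have h1 := hF.card_eq
      rw [h.card_family, Finset.card_sdiff_of_subset hD, Nat.card_Icc] at h1
      have h2 := Finset.card_le_card hD
      rw [Nat.card_Icc] at h2
      omega
    · rw [optionsOf]
      split_ifs with hl
      · rw [Finset.mem_singleton]
        have := h.first_nonmin x (by rwa [hmin, icc_sdiff_coe hD])
        obtain ⟨B, hB, h1, h2⟩ := this
        exact hF.minimaOver_eq_replicate hB h1 h2 (hle x)
      · rw [mem_boundedMultisets, card_minimaOver]
        exact ⟨hF.mem_gapBelow_of_mem hD hx, hle x⟩
  · rintro ⟨D, hD, ⟨hF, hopt⟩, hmin⟩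
    rw [Finset.mem_powersetCard] at hD
    have hcard : (Finset.Icc 1 N \ D).card = r := by
      rw [Finset.card_sdiff_of_subset hD.1, Nat.card_Icc, hD.2]
      omega
    refine ⟨(card_parts_eq hmin).trans hcard, hF.card_eq.trans hcard, hF.nonempty, hF.segmented,
      ?_, hF.min_once, hmin.trans hF.min_eq.symm, ?_⟩
    · rw [Multiset.le_iff_count]
      intro a
      rw [count_fullMultiset]
      split_ifs with ha
      · by_cases ha' : a ∈ familyMin π₀
        · rw [hF.min_once a ha']
          omega
        · have h1 := hopt a (hF.mem_insert_of_notMem (by simpa using ha) ha')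
          rw [← card_minimaOver]
          rw [optionsOf] at h1
          split_ifs at h1
          · rw [Finset.mem_singleton.1 h1, Multiset.card_replicate]
          · exact (mem_boundedMultisets.1 h1).2
      · rw [Nat.le_zero, Multiset.count_eq_zero, mem_familySum]
        rintro ⟨B, hB, haB⟩
        exact ha (by simpa using hF.ground B hB a haB)
    · intro x hx
      rw [hmin, icc_sdiff_coe hD.1] at hx
      have h1 := hopt x (Finset.mem_insert_of_mem hx.1)
      rw [optionsOf, if_pos hx, Finset.mem_singleton] at h1
      exact hF.exists_of_minimaOver_eq_replicate (by omega) h1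

/-- The exact multiplicity `k - 2` becomes the cardinality of `minimaOver`; the absence of
repetition within a block becomes `Nodup`, since distinct blocks have distinct minima. -/
theorem isPermutationPair_iff {k N n : ℕ} (hk : 2 < k)
    (σ₀ : Finset (Multiset ℕ)) (σ₁ : Equiv.Perm (Fin N)) :
    IsPermutationPair k N ((N : ℤ) - n) σ₀ σ₁ ↔ ∃ D ∈ (Finset.Icc 1 N).powersetCard n,
      (IsMinFamily N D σ₀ ∧ ∀ x ∈ insert (N + 1) D, minimaOver σ₀ x ∈
        optionsOf (k - 2) (subsetMultisets · (k - 2)) D x) ∧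
      lmin σ₁ = ↑(Finset.Icc 1 N \ D) := by
  classical
  constructor
  · intro h
    have hsub : lmin σ₁ ⊆ Finset.Icc 1 N := by
      rintro _ ⟨p, rfl, -⟩
      rw [Finset.mem_coe, Finset.mem_Icc]
      omega
    set D := (Finset.Icc 1 N).filter (· ∉ lmin σ₁) with hDdef
    have hD : D ⊆ Finset.Icc 1 N := Finset.filter_subset _ _
    have hmin : lmin σ₁ = ↑(Finset.Icc 1 N \ D) := by
      ext a
      simp only [hDdef, Finset.coe_sdiff, Finset.coe_filter, Set.mem_sdiff, Finset.mem_coe,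
        Set.mem_ofPred_eq, not_and_not_right]
      exact ⟨fun ha => ⟨hsub ha, fun _ => ha⟩, fun ha => ha.2 ha.1⟩
    have hF : IsMinFamily N D σ₀ :=
      { ground := fun B hB y hy => (h.mem_iff y).1 (mem_familySum.2 ⟨B, hB, hy⟩)
        nonempty := h.nonempty
        segmented := h.segmented
        min_once := h.min_once
        min_eq := h.min_eq.symm.trans hmin }
    have hcount : ∀ x ∈ insert (N + 1) D, (familySum σ₀).count x = k - 2 := by
      intro x hx
      refine h.nonmin_count x ?_ ?_
      · rcases Finset.mem_insert.1 hx with rfl | hx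
        · simp
        · have := Finset.mem_Icc.1 (hD hx)
          exact ⟨this.1, by omega⟩
      · rw [hF.min_eq, Finset.mem_coe, Finset.mem_sdiff, Finset.mem_Icc]
        rintro ⟨h1, h2⟩
        rcases Finset.mem_insert.1 hx with rfl | hx
        · omega
        · exact h2 hx
    refine ⟨D, Finset.mem_powersetCard.2 ⟨hD, ?_⟩, ⟨hF, fun x hx => ?_⟩, hmin⟩
    · have h1 := h.card_family
      rw [hF.card_eq, Finset.card_sdiff_of_subset hD, Nat.card_Icc] at h1
      have h2 := Finset.card_le_card hD
      rw [Nat.card_Icc] at h2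
      omega
    · rw [optionsOf]
      split_ifs with hl
      · rw [Finset.mem_singleton]
        obtain ⟨B, hB, h1, h2⟩ := h.first_nonmin x (by rwa [hmin, icc_sdiff_coe hD])
        exact hF.minimaOver_eq_replicate hB h1 h2 (hcount x hx).le
      · rw [mem_subsetMultisets, card_minimaOver]
        refine ⟨hF.mem_gapBelow_of_mem hD hx, hcount x hx, ?_⟩
        rw [Multiset.nodup_iff_count_le_one]
        intro a
        by_cases ha : a ∈ minimaOver σ₀ x
        · obtain ⟨B, hB, -, rfl⟩ := mem_minimaOver.1 ha
          rw [hF.count_minimaOver hB]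
          exact h.no_repeat x (by rwa [hmin, icc_sdiff_coe hD]) B hB
        · rw [Multiset.count_eq_zero.2 ha]
          exact Nat.zero_le _
  · rintro ⟨D, hD, ⟨hF, hopt⟩, hmin⟩
    rw [Finset.mem_powersetCard] at hD
    have hDN := Finset.card_le_card hD.1
    rw [Nat.card_Icc] at hDN
    have hcard : ((Finset.Icc 1 N \ D).card : ℤ) = (N : ℤ) - n := by
      rw [Finset.card_sdiff_of_subset hD.1, Nat.card_Icc, hD.2]
      omega
    have hcount : ∀ x ∈ insert (N + 1) D, (familySum σ₀).count x = k - 2 := by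
      intro x hx
      have h1 := hopt x hx
      rw [← card_minimaOver]
      rw [optionsOf] at h1
      split_ifs at h1
      · rw [Finset.mem_singleton.1 h1, Multiset.card_replicate]
      · exact (mem_subsetMultisets.1 h1).2.1
    refine ⟨by rw [hmin, Set.ncard_coe_finset, hcard], by rw [hF.card_eq, hcard], hF.nonempty,
      hF.segmented, fun a => ⟨?_, fun ha => ?_⟩, hF.min_once,
      fun a ha ha' => hcount a (hF.mem_insert_of_notMem ha ha'), hmin.trans hF.min_eq.symm,
      fun x hx => ?_, fun y hy B hB => ?_⟩
    · rw [mem_familySum]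
      rintro ⟨B, hB, haB⟩
      exact hF.ground B hB a haB
    · rw [← Multiset.count_pos]
      by_cases ha' : a ∈ familyMin σ₀
      · rw [hF.min_once a ha']
        exact one_pos
      · rw [hcount a (hF.mem_insert_of_notMem ha ha')]
        omega
    · rw [hmin, icc_sdiff_coe hD.1] at hx
      have h1 := hopt x (Finset.mem_insert_of_mem hx.1)
      rw [optionsOf, if_pos hx, Finset.mem_singleton] at h1
      exact hF.exists_of_minimaOver_eq_replicate (by omega) h1
    · rw [hmin, icc_sdiff_coe hD.1] at hy
      by_cases hyB : y ∈ B
      · by_cases hy' : y ∈ familyMin σ₀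
        · rw [← hF.min_once y hy', count_familySum]
          exact Finset.single_le_sum (f := fun B : Multiset ℕ => B.count y)
            (fun _ _ => Nat.zero_le _) hB
        · have h1 := hopt y (hF.mem_insert_of_notMem (hF.ground B hB y hyB) hy')
          rw [optionsOf, if_neg hy, mem_subsetMultisets] at h1
          rw [← hF.count_minimaOver hB]
          exact Multiset.nodup_iff_count_le_one.1 h1.2.2 _
      · rw [Multiset.count_eq_zero.2 hyB]
        exact Nat.zero_le _

open Classical in
theorem ncard_pairs_eq_sum {β : Type*} [Fintype β] {N n e : ℕ} (hn : 1 ≤ n)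
    {f : Finset ℕ → Finset (Multiset ℕ)} {c : ℕ → ℕ}
    (hf : ∀ g, ∀ s ∈ f g, ∀ a ∈ s, a ∈ g) (hc : ∀ g, (f g).card = c g.card)
    (S : Set (Finset (Multiset ℕ) × β)) (mins : β → Set ℕ) (u : Finset ℕ → ℕ)
    (hu : ∀ D ⊆ Finset.Icc 1 N,
      (Finset.univ.filter fun b => mins b = ↑(Finset.Icc 1 N \ D)).card = u D)
    (hu1 : ∀ D, 1 ∈ D → u D = 0)
    (hS : ∀ a b, (a, b) ∈ S ↔ ∃ D ∈ (Finset.Icc 1 N).powersetCard n,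
      (IsMinFamily N D a ∧ ∀ x ∈ insert (N + 1) D, minimaOver a x ∈ optionsOf e f D x) ∧
      mins b = ↑(Finset.Icc 1 N \ D)) :
    S.ncard = ∑ D ∈ (Finset.Icc 1 N).powersetCard n, u D * gapProd c N D := by
  rw [ncard_pairs N n S (fun D => familiesWith N D (optionsOf e f D)) mins]
  · refine Finset.sum_congr rfl fun D hD => ?_
    rw [Finset.mem_powersetCard] at hD
    rw [hu D hD.1, mul_comm]
    -- When `1 ∈ D`, the forced choice lies outside the gap and the count of families is not
    -- available, but `1` is always a minimum, so `u D = 0`.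
    by_cases h1 : 1 ∈ D
    · rw [hu1 D h1, zero_mul, zero_mul]
    · rw [card_familiesWith_optionsOf hf hc hD.1 h1 (Finset.card_pos.1 (by omega))]
  · intro a b
    rw [hS]
    refine exists_congr fun D => and_congr_right fun hD => and_congr_left fun hb => ?_
    rw [Finset.mem_powersetCard] at hD
    have h1 : 1 ∉ D := fun h1 => by
      have h0 := hu D hD.1
      rw [hu1 D h1, Finset.card_eq_zero, Finset.filter_eq_empty_iff] at h0
      exact h0 (Finset.mem_univ b) hb
    exact (mem_familiesWith hD.1 (mem_gapBelow_of_mem_optionsOf hf hD.1 h1)).symm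

theorem secondKind_eq_sum {k n : ℕ} (hk : 2 < k) (hn : 1 ≤ n) (m : ℕ) :
    secondKind k (n + m) m = ∑ D ∈ (Finset.Icc 1 (n + m)).powersetCard n,
      (∏ x ∈ D, (Finset.Ico 1 x \ D).card) *
        gapProd (fun g => (g + (k - 2)).choose (k - 2)) (n + m) D := by
  classical
  refine ncard_pairs_eq_sum hn (e := k - 2) (f := (boundedMultisets · (k - 2)))
    (fun g s hs => (mem_boundedMultisets.1 hs).1) (fun g => card_boundedMultisets g _) _
    partitionMin (fun D => ∏ x ∈ D, (Finset.Ico 1 x \ D).card) (fun D hD => ?_)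
    (fun D hD => Finset.prod_eq_zero hD (by simp)) fun a b => isPartitionPair_iff hk rfl a b
  rw [← card_partitions hD]

theorem firstKind_eq_sum {k n : ℕ} (hk : 2 < k) (hn : 1 ≤ n) (m : ℕ) :
    firstKind k m ((m : ℤ) - n) = ∑ D ∈ (Finset.Icc 1 m).powersetCard n,
      (∏ x ∈ D, (x - 1)) * gapProd (fun g => g.choose (k - 2)) m D := by
  classical
  refine ncard_pairs_eq_sum hn (e := k - 2) (f := (subsetMultisets · (k - 2)))
    (fun g s hs => (mem_subsetMultisets.1 hs).1) (fun g => card_subsetMultisets g _) _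
    lmin (fun D => ∏ x ∈ D, (x - 1)) (fun D hD => ?_)
    (fun D hD => Finset.prod_eq_zero hD (by simp)) fun a b => isPermutationPair_iff hk a b
  rw [← card_permutations hD]

end Pairs

/-! ### Stirling permutations as words, and their descents -/

section Words

/-- Insertion of `k` copies of `c` at position `p`. -/
def insertBlock (k c p : ℕ) (l : List ℕ) : List ℕ :=
  l.take p ++ (List.replicate k c ++ l.drop p)

/-- The Stirling permutations of `{0^k, …, (n-1)^k}`, as lists. -/
def stirlingLists (k : ℕ) : ℕ → Finset (List ℕ)
  | 0 => {[]}
  | n + 1 => (stirlingLists k n ×ˢ Finset.range (k * n + 1)).image fun q => insertBlock k n q.2 q.1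

/-- The number of descents of a word, the last index of a nonempty word being a descent. -/
def desCount : List ℕ → ℕ
  | [] => 0
  | [_] => 1
  | a :: b :: l => (if b < a then 1 else 0) + desCount (b :: l)

/-- The Stirling permutations of `{0^k, …, (n-1)^k}`. -/
structure IsStirlingList (k n : ℕ) (l : List ℕ) : Prop where
  lt : ∀ a ∈ l, a < n
  count : ∀ a < n, l.count a = k
  le : ∀ a b, [a, b, a].Sublist l → a ≤ b

theorem cons_sublist_of_append {α : Type*} {a : α} {s u w : List α} (h : (a :: s).Sublist (u ++ w))
    (ha : a ∉ u) : (a :: s).Sublist w := by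
  induction u with
  | nil => exact h
  | cons x u ih =>
    rw [List.mem_cons, not_or] at ha
    rw [List.cons_append] at h
    cases h with
    | cons _ h => exact ih h ha.2
    | cons_cons _ h => exact (ha.1 rfl).elim

theorem exists_eq_replicate_append {n : ℕ} {t : List ℕ} (h : ∀ b, [b, n].Sublist t → b = n) :
    ∃ v, t = List.replicate (t.count n) n ++ v ∧ n ∉ v := by
  induction t with
  | nil => exact ⟨[], by simp, by simp⟩
  | cons x t ih =>
    by_cases hx : x = n
    · obtain ⟨v, hv, hnv⟩ := ih fun b hb => h b (hb.cons x)
      refine ⟨v, ?_, hnv⟩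
      rw [hx, List.count_cons_self, List.replicate_succ, List.cons_append, ← hv]
    · have hn : n ∉ x :: t := by
        rw [List.mem_cons, not_or]
        refine ⟨Ne.symm hx, fun hm => hx (h x ?_)⟩
        exact (List.singleton_sublist.2 hm).cons_cons x
      exact ⟨x :: t, by rw [List.count_eq_zero.2 hn]; rfl, hn⟩

/-- No letter smaller than `n` may stand between two copies of the largest letter `n`, so these
copies are contiguous. Conversely, inserting such a block puts no smaller letter between equal ones.
-/
theorem isStirlingList_succ_iff {k n : ℕ} (hk : 0 < k) (l : List ℕ) :
    IsStirlingList k (n + 1) l ↔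
      ∃ u v, IsStirlingList k n (u ++ v) ∧ l = u ++ (List.replicate k n ++ v) := by
  constructor
  · intro h
    have hn : n ∈ l := List.count_pos_iff.1 (by rw [h.count n (by omega)]; exact hk)
    obtain ⟨u, t, rfl, hu⟩ := List.eq_append_cons_of_mem hn
    obtain ⟨v, hv, hnv⟩ := exists_eq_replicate_append (n := n) (t := t) fun b hb => by
      have h1 := h.le n b ((hb.cons_cons n).trans (List.sublist_append_right _ _))
      have h2 := h.lt b (by
        have := hb.subset (List.mem_cons_self)
        simp [this])
      omega
    have hc : t.count n + 1 = k := by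
      have := h.count n (by omega)
      rwa [List.count_append, List.count_eq_zero.2 hu, zero_add, List.count_cons_self] at this
    have ht : n :: t = List.replicate k n ++ v := by
      rw [← hc, List.replicate_succ, List.cons_append, ← hv]
    rw [ht] at h ⊢
    refine ⟨u, v, ⟨fun a ha => ?_, fun a ha => ?_, fun a b hab => ?_⟩, rfl⟩
    · have h1 : a ∈ u ++ (List.replicate k n ++ v) := by
        rcases List.mem_append.1 ha with h | h <;> simp [h]
      have h2 := h.lt a h1
      have h3 : a ≠ n := by
        rintro rfl
        rcases List.mem_append.1 ha with h | h
        · exact hu h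
        · exact hnv h
      omega
    · have := h.count a (by omega)
      rwa [List.count_append, List.count_append, List.count_replicate, if_neg (by simp; omega),
        zero_add, ← List.count_append] at this
    · exact h.le a b (hab.trans ((List.Sublist.refl u).append (List.sublist_append_right _ v)))
  · rintro ⟨u, v, h, rfl⟩
    have hnu : n ∉ u := fun hn => lt_irrefl _ (h.lt n (List.mem_append_left _ hn))
    have hnv : n ∉ v := fun hn => lt_irrefl _ (h.lt n (List.mem_append_right _ hn))
    have hle : ∀ a ∈ u ++ (List.replicate k n ++ v), a < n + 1 := by
      intro a ha
      simp only [List.mem_append, List.mem_replicate] at ha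
      rcases ha with ha | ⟨-, rfl⟩ | ha
      · exact (h.lt a (List.mem_append_left _ ha)).trans (Nat.lt_succ_self _)
      · exact Nat.lt_succ_self _
      · exact (h.lt a (List.mem_append_right _ ha)).trans (Nat.lt_succ_self _)
    refine ⟨hle, fun a ha => ?_, fun a b hab => ?_⟩
    · rw [List.count_append, List.count_append, List.count_replicate]
      rcases Nat.lt_succ_iff_lt_or_eq.1 ha with ha | rfl
      · rw [if_neg (by simp; omega), zero_add, ← List.count_append, h.count a ha]
      · rw [List.count_eq_zero.2 hnu, List.count_eq_zero.2 hnv]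
        simp
    · have ha : a < n + 1 := hle a (hab.subset (by simp))
      by_cases hb : b = n
      · omega
      by_cases han : a = n
      · exfalso
        subst han
        -- The first `n` of the pattern is not in `u`. Either the whole pattern lies in the block,
        -- so that `b = n`, or its last letter `n` lies in `v`; both are impossible.
        obtain ⟨s, s', hs, h1, h2⟩ := List.sublist_append_iff.1 (cons_sublist_of_append hab hnu)
        rcases List.eq_nil_or_concat s' with rfl | ⟨s'', z, rfl⟩
        · rw [List.append_nil] at hs
          rw [← hs] at h1
          exact hb (List.eq_of_mem_replicate (h1.subset (show b ∈ [a, b, a] by simp)))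
        · have hz : a = z := by
            have := congrArg List.getLast? hs
            simpa using this
          subst hz
          exact hnv (h2.subset (by simp))
      · refine h.le a b ?_
        -- Deleting the letter `n` turns the long word into `u ++ v` and leaves the pattern
        -- unchanged.
        have hf := hab.filter (fun x => decide (x ≠ n))
        have hfu : u.filter (fun x => decide (x ≠ n)) = u :=
          List.filter_eq_self.2 fun x hx => by simpa using fun h : x = n => hnu (h ▸ hx)
        have hfv : v.filter (fun x => decide (x ≠ n)) = v :=
          List.filter_eq_self.2 fun x hx => by simpa using fun h : x = n => hnv (h ▸ hx)
        rw [List.filter_append, List.filter_append, hfu, hfv] at hf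
        simpa [han, hb] using hf

theorem isStirlingList_zero_iff {k : ℕ} (l : List ℕ) : IsStirlingList k 0 l ↔ l = [] := by
  constructor
  · intro h
    exact List.eq_nil_iff_forall_not_mem.2 fun a ha => Nat.not_lt_zero _ (h.lt a ha)
  · rintro rfl
    exact ⟨by simp, by simp, by simp⟩

theorem length_of_mem_stirlingLists {k n : ℕ} {l : List ℕ} (h : l ∈ stirlingLists k n) :
    l.length = k * n := by
  induction n generalizing l with
  | zero =>
    rw [stirlingLists, Finset.mem_singleton] at h
    rw [h]
    rfl
  | succ n ih =>
    rw [stirlingLists, Finset.mem_image] at h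
    obtain ⟨⟨l', p⟩, hq, rfl⟩ := h
    rw [Finset.mem_product, Finset.mem_range] at hq
    have := ih hq.1
    dsimp only at this
    simp only [insertBlock, List.length_append, List.length_take, List.length_replicate,
      List.length_drop, Nat.mul_succ]
    omega

theorem mem_stirlingLists {k n : ℕ} (hk : 0 < k) {l : List ℕ} :
    l ∈ stirlingLists k n ↔ IsStirlingList k n l := by
  induction n generalizing l with
  | zero => rw [stirlingLists, Finset.mem_singleton, isStirlingList_zero_iff]
  | succ n ih =>
    rw [stirlingLists, isStirlingList_succ_iff hk, Finset.mem_image]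
    constructor
    · rintro ⟨⟨l', p⟩, hq, rfl⟩
      rw [Finset.mem_product] at hq
      exact ⟨l'.take p, l'.drop p, by rw [List.take_append_drop]; exact ih.1 hq.1, rfl⟩
    · rintro ⟨u, v, h, rfl⟩
      have hm := ih.2 h
      have hl := length_of_mem_stirlingLists hm
      rw [List.length_append] at hl
      refine ⟨(u ++ v, u.length), ?_, by simp [insertBlock]⟩
      rw [Finset.mem_product, Finset.mem_range]
      exact ⟨hm, by dsimp only; omega⟩

/-- Deleting the letter `n` recovers the word, and the number of letters before the first `n`
recovers the position. -/
theorem insertBlock_injOn {k n : ℕ} (hk : 0 < k) :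
    Set.InjOn (fun q : List ℕ × ℕ => insertBlock k n q.2 q.1)
      ((stirlingLists k n ×ˢ Finset.range (k * n + 1) : Finset (List ℕ × ℕ)) :
        Set (List ℕ × ℕ)) := by
  have key : ∀ q ∈ stirlingLists k n ×ˢ Finset.range (k * n + 1),
      (insertBlock k n q.2 q.1).filter (fun x => decide (x ≠ n)) = q.1 ∧
      ((insertBlock k n q.2 q.1).takeWhile (fun x => decide (x ≠ n))).length = q.2 := by
    rintro ⟨l, p⟩ hq
    rw [Finset.mem_product, Finset.mem_range] at hq
    have hn : ∀ x ∈ l, decide (x ≠ n) = true := fun x hx => by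
      simpa using (((mem_stirlingLists hk).1 hq.1).lt x hx).ne
    have hlen := length_of_mem_stirlingLists hq.1
    constructor
    · simp only [insertBlock]
      rw [List.filter_append, List.filter_append,
        List.filter_eq_self.2 fun x hx => hn x (List.mem_of_mem_take hx),
        List.filter_eq_self.2 fun x hx => hn x (List.mem_of_mem_drop hx)]
      simp
    · simp only [insertBlock]
      rw [List.takeWhile_append_of_pos fun x hx => hn x (List.mem_of_mem_take hx)]
      obtain ⟨k, rfl⟩ := Nat.exists_eq_succ_of_ne_zero hk.ne'
      rw [List.replicate_succ, List.cons_append, List.takeWhile_cons_of_neg (by simp)]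
      simp only [List.append_nil, List.length_take]
      have := hq.2
      dsimp only at this hlen
      omega
  intro q hq q' hq' h
  dsimp only at h
  have h1 := key q hq
  have h2 := key q' hq'
  rw [h] at h1
  exact Prod.ext (h1.1.symm.trans h2.1) (h1.2.symm.trans h2.2)

theorem desCount_replicate_append {k c : ℕ} (hk : 0 < k) {l : List ℕ} (hl : ∀ a ∈ l, a < c) :
    desCount (List.replicate k c ++ l) = desCount l + 1 := by
  induction k with
  | zero => exact absurd hk (lt_irrefl _)
  | succ k ih =>
    rcases Nat.eq_zero_or_pos k with rfl | hk'
    · cases l with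
      | nil => rfl
      | cons a l =>
        simp [desCount, hl a (by simp), add_comm]
    · rw [← ih hk']
      obtain ⟨k, rfl⟩ := Nat.exists_eq_succ_of_ne_zero hk'.ne'
      simp [List.replicate_succ, desCount]

/-- The distribution of the number of descents over the insertions of a block of maximal letters. -/
theorem sum_insertBlock {R : Type*} [CommRing R] {k c : ℕ} (hk : 0 < k) (l : List ℕ)
    (hl : ∀ a ∈ l, a < c) (φ : ℕ → R) :
    ∑ p ∈ Finset.range (l.length + 1), φ (desCount (insertBlock k c p l)) =
      desCount l * φ (desCount l) + (l.length + 1 - desCount l) * φ (desCount l + 1) := by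
  have h0 : ∀ l : List ℕ, (∀ a ∈ l, a < c) → desCount (insertBlock k c 0 l) = desCount l + 1 :=
    fun l hl => desCount_replicate_append hk hl
  have hhead : ∀ l, ∃ s, insertBlock k c 0 l = c :: s := fun l => by
    obtain ⟨k, rfl⟩ := Nat.exists_eq_succ_of_ne_zero hk.ne'
    exact ⟨_, rfl⟩
  have hcons : ∀ a l, a < c → desCount (a :: insertBlock k c 0 l) =
      desCount (insertBlock k c 0 l) := fun a l hac => by
    obtain ⟨s, hs⟩ := hhead l
    rw [hs, desCount, if_neg hac.asymm, zero_add]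
  induction l generalizing φ with
  | nil => simp [h0, desCount]
  | cons a t ih =>
    have ht : ∀ a ∈ t, a < c := fun x hx => hl x (List.mem_cons_of_mem _ hx)
    have hac : a < c := hl a List.mem_cons_self
    have hstep : ∀ p, insertBlock k c (p + 1) (a :: t) = a :: insertBlock k c p t := fun p => rfl
    rw [Finset.sum_range_succ', h0 _ hl, List.length_cons]
    simp only [hstep]
    rw [Finset.sum_range_succ', hcons a t hac, h0 t ht]
    cases t with
    | nil => simp [desCount]
    | cons b t =>
      have hrec : ∀ p, desCount (a :: insertBlock k c (p + 1) (b :: t)) =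
          (if b < a then 1 else 0) + desCount (insertBlock k c (p + 1) (b :: t)) := fun p => rfl
      have hd : desCount (a :: b :: t) = (if b < a then 1 else 0) + desCount (b :: t) := rfl
      simp only [hrec, hd]
      -- Position `0` adds a descent and position `1` destroys a possible descent from `a` to `b`.
      -- Later positions keep that descent, so `φ` is shifted by it.
      have h := ih ht fun d => φ ((if b < a then 1 else 0) + d)
      rw [Finset.sum_range_succ', h0 _ ht] at h
      rw [eq_sub_of_add_eq h]
      split_ifs
      · rw [add_comm 1 (desCount (b :: t)), add_comm 1 (desCount (b :: t) + 1)]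
        push_cast
        ring
      · simp only [zero_add]
        push_cast
        ring

theorem sum_stirlingLists_succ {R : Type*} [CommRing R] {k n : ℕ} (hk : 0 < k) (φ : ℕ → R) :
    ∑ l ∈ stirlingLists k (n + 1), φ (desCount l) =
      ∑ l ∈ stirlingLists k n, (desCount l * φ (desCount l) +
        ((k * n : ℕ) + 1 - desCount l) * φ (desCount l + 1)) := by
  rw [stirlingLists, Finset.sum_image (insertBlock_injOn hk), Finset.sum_product]
  refine Finset.sum_congr rfl fun l hl => ?_
  have h := sum_insertBlock hk l ((mem_stirlingLists hk).1 hl).lt φ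
  rwa [length_of_mem_stirlingLists hl] at h

theorem desCount_pos : ∀ {l : List ℕ}, l ≠ [] → 0 < desCount l
  | [_], _ => one_pos
  | _ :: b :: l, _ => Nat.add_pos_right _ (desCount_pos (List.cons_ne_nil b l))

theorem desCount_le_of_mem {k n : ℕ} (hk : 0 < k) {l : List ℕ} (h : l ∈ stirlingLists k n) :
    desCount l ≤ n := by
  induction n generalizing l with
  | zero =>
    rw [stirlingLists, Finset.mem_singleton] at h
    rw [h]
    rfl
  | succ n ih =>
    -- The test function is the indicator of more than `n + 1` descents; its sum vanishes, hence so
    -- does each of its nonnegative terms.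
    have hs := sum_stirlingLists_succ (R := ℚ) (n := n) hk fun d => if d ≤ n + 1 then 0 else 1
    rw [Finset.sum_eq_zero (s := stirlingLists k n), Finset.sum_eq_zero_iff_of_nonneg] at hs
    · by_contra hl
      simpa [hl] using hs l h
    · intro l _
      split_ifs <;> norm_num
    · intro l hl
      have := ih hl
      rw [if_pos (by omega), if_pos (by omega)]
      ring

theorem desCount_eq_sum : ∀ l : List ℕ, desCount l = ∑ p ∈ Finset.range l.length,
    if p + 1 = l.length ∨ l.getD (p + 1) 0 < l.getD p 0 then 1 else 0
  | [] => rfl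
  | [a] => by
    rw [List.length_singleton, Finset.sum_range_one, if_pos (Or.inl rfl)]
    rfl
  | a :: b :: l => by
    have h := desCount_eq_sum (b :: l)
    have hlen : (a :: b :: l).length = (b :: l).length + 1 := rfl
    rw [hlen, Finset.sum_range_succ', desCount, h, add_comm]
    congr 1
    · refine Finset.sum_congr rfl fun p _ => ?_
      simp only [List.getD_cons_succ, Nat.add_right_cancel_iff]
    · simp

/-- The list of the letters of a word. -/
def wordList {K n : ℕ} (w : Fin K → Fin n) : List ℕ :=
  List.ofFn fun i => (w i).val

theorem wordList_injective (K n : ℕ) :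
    Function.Injective (wordList : (Fin K → Fin n) → List ℕ) := by
  intro w w' h
  have := List.ofFn_injective h
  funext i
  exact Fin.ext (congrFun this i)

theorem count_wordList {K n : ℕ} (w : Fin K → Fin n) (a : Fin n) :
    (wordList w).count a.val = (Finset.univ.filter fun p => w p = a).card := by
  rw [← Multiset.coe_count, wordList, ← Fin.univ_val_map, Multiset.count_map, Finset.card_def,
    Finset.filter_val]
  congr 2
  ext p
  rw [Fin.ext_iff, eq_comm]

theorem sublist_wordList_iff {K n : ℕ} (w : Fin K → Fin n) (a b : ℕ) :
    [a, b, a].Sublist (wordList w) ↔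
      ∃ i s j, i < s ∧ s < j ∧ (w i).val = a ∧ (w s).val = b ∧ (w j).val = a := by
  have hlen : (wordList w).length = K := List.length_ofFn
  rw [List.sublist_iff_exists_fin_orderEmbedding_get_eq]
  constructor
  · rintro ⟨f, hf⟩
    refine ⟨Fin.cast hlen (f 0), Fin.cast hlen (f 1), Fin.cast hlen (f 2), ?_, ?_, ?_, ?_, ?_⟩
    · exact f.strictMono (show (0 : Fin 3) < 1 by decide)
    · exact f.strictMono (show (1 : Fin 3) < 2 by decide)
    · have := hf 0
      simpa [wordList, Fin.cast] using this.symm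
    · have := hf 1
      simpa [wordList, Fin.cast] using this.symm
    · have := hf 2
      simpa [wordList, Fin.cast] using this.symm
  · rintro ⟨i, s, j, his, hsj, hi, hs, hj⟩
    have hmono : StrictMono ![i, s, j] := by
      rw [Fin.strictMono_iff_lt_succ]
      intro x
      fin_cases x
      · exact his
      · exact hsj
    refine ⟨OrderEmbedding.ofStrictMono
      (fun x : Fin 3 => Fin.cast hlen.symm (![i, s, j] x)) fun x y h => hmono h, fun x => ?_⟩
    simp only [wordList, List.get_ofFn]
    fin_cases x
    · exact hi.symm
    · exact hs.symm
    · exact hj.symm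

theorem isStirlingList_wordList_iff {k n K : ℕ} (w : Fin K → Fin n) :
    IsStirlingList k n (wordList w) ↔
      (∀ a, (Finset.univ.filter fun p => w p = a).card = k) ∧
        ∀ i s j, i < s → s < j → w i = w j → w i ≤ w s := by
  constructor
  · intro h
    refine ⟨fun a => by rw [← count_wordList, h.count a a.2], fun i s j his hsj hij => ?_⟩
    exact h.le _ _ ((sublist_wordList_iff w _ _).2 ⟨i, s, j, his, hsj, rfl, rfl, by rw [hij]⟩)
  · rintro ⟨h1, h2⟩
    refine ⟨fun a ha => ?_, fun a ha => ?_, fun a b hab => ?_⟩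
    · obtain ⟨i, rfl⟩ := List.mem_ofFn.1 ha
      exact (w i).2
    · rw [← h1 ⟨a, ha⟩, ← count_wordList]
    · obtain ⟨i, s, j, his, hsj, rfl, rfl, hj⟩ := (sublist_wordList_iff w _ _).1 hab
      exact h2 i s j his hsj (Fin.ext hj.symm)

theorem ncard_descents {K n : ℕ} (w : Fin K → Fin n) :
    (descents w).ncard = desCount (wordList w) := by
  have hlen : (wordList w).length = K := List.length_ofFn
  have hget : ∀ (p : ℕ) (hp : p < K), (wordList w).getD p 0 = (w ⟨p, hp⟩).val := fun p hp => by
    rw [List.getD_eq_getElem _ _ (by rwa [hlen])]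
    simp [wordList]
  rw [desCount_eq_sum, ← Finset.card_filter, ← Set.ncard_coe_finset, hlen,
    ← Set.ncard_image_of_injective _ Fin.val_injective]
  congr 1
  ext p
  simp only [Set.mem_image, descents, Set.mem_ofPred_eq, Finset.coe_filter, Finset.mem_range]
  constructor
  · rintro ⟨q, hq, rfl⟩
    refine ⟨q.2, ?_⟩
    rcases hq with hq | ⟨h, hq⟩
    · exact Or.inl hq
    · right
      rw [hget _ h, hget _ q.2]
      exact hq
  · rintro ⟨hp, h⟩
    refine ⟨⟨p, hp⟩, ?_, rfl⟩
    by_cases hK : p + 1 = K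
    · exact Or.inl hK
    · right
      have hlt : p + 1 < K := by omega
      refine ⟨hlt, ?_⟩
      have := h.resolve_left hK
      rwa [hget _ hlt, hget _ hp] at this

theorem eulerianNumber_eq_card {k n : ℕ} (hk : 0 < k) (i : ℕ) :
    eulerianNumber (fun _ : Fin n => k) i =
      ((stirlingLists k n).filter fun l => desCount l = i).card := by
  have hK : ∑ _a : Fin n, k = k * n := by simp [mul_comm]
  rw [eulerianNumber, ← Set.ncard_image_of_injective _ (wordList_injective _ _),
    ← Set.ncard_coe_finset]
  congr 1
  ext l
  simp only [Set.mem_image, Set.mem_ofPred_eq, Finset.coe_filter, StirlingPerms, ncard_descents,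
    ← isStirlingList_wordList_iff, mem_stirlingLists hk]
  constructor
  · rintro ⟨w, ⟨h1, h2⟩, rfl⟩
    exact ⟨h1, h2⟩
  · rintro ⟨h1, h2⟩
    have hlen : ∑ _a : Fin n, k = l.length :=
      hK.trans (length_of_mem_stirlingLists ((mem_stirlingLists hk).2 h1)).symm
    have hw : wordList (fun i : Fin (∑ _a : Fin n, k) =>
        (⟨l[i.val]'(hlen ▸ i.2), h1.lt _ (List.getElem_mem _)⟩ : Fin n)) = l := by
      refine List.ext_getElem ?_ fun i hi hi' => ?_
      · simp [wordList, ← hlen]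
      · simp [wordList]
    exact ⟨_, ⟨by rwa [hw], by rwa [hw]⟩, hw⟩

theorem sum_eulerianNumber {R : Type*} [CommRing R] {k n : ℕ} (hk : 0 < k) (hn : 0 < n)
    (φ : ℕ → R) :
    ∑ i ∈ Finset.Icc 1 n, (eulerianNumber (fun _ : Fin n => k) i : R) * φ i =
      ∑ l ∈ stirlingLists k n, φ (desCount l) := by
  rw [← Finset.sum_fiberwise_of_maps_to (s := stirlingLists k n) (t := Finset.Icc 1 n)
    (g := desCount)]
  · refine Finset.sum_congr rfl fun i _ => ?_
    rw [eulerianNumber_eq_card hk, Finset.sum_congr rfl fun l hl => by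
      rw [(Finset.mem_filter.1 hl).2], Finset.sum_const, nsmul_eq_mul]
  · intro l hl
    rw [Finset.mem_Icc]
    refine ⟨desCount_pos fun h => ?_, desCount_le_of_mem hk hl⟩
    have := length_of_mem_stirlingLists hl
    rw [h, List.length_nil] at this
    exact (Nat.mul_pos hk hn).ne this

end Words

/-! ### Differential recursions for the generating series -/

section Series

open PowerSeries

/-- The descent polynomial of the Stirling permutations, as a power series. -/
noncomputable def descentSeries (k n : ℕ) : ℚ⟦X⟧ :=
  ∑ l ∈ stirlingLists k n, X ^ desCount l

/-- The reversed descent polynomial of the Stirling permutations, as a power series. -/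
noncomputable def reversedSeries (k n : ℕ) : ℚ⟦X⟧ :=
  ∑ l ∈ stirlingLists k n, X ^ (k * n + 1 - desCount l)

theorem X_mul_derivative_X_pow (d : ℕ) :
    (X : ℚ⟦X⟧) * derivative ℚ (X ^ d) = (d : ℚ⟦X⟧) * X ^ d := by
  rw [Derivation.leibniz_pow, derivative_X]
  rcases d with _ | d
  · simp
  · rw [Nat.add_sub_cancel, pow_succ, smul_eq_mul, mul_one, nsmul_eq_mul]
    ring

theorem X_mul_derivative_descentSeries (k n : ℕ) :
    X * derivative ℚ (descentSeries k n) =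
      ∑ l ∈ stirlingLists k n, (desCount l : ℚ⟦X⟧) * X ^ desCount l := by
  rw [descentSeries, map_sum, Finset.mul_sum]
  exact Finset.sum_congr rfl fun l _ => X_mul_derivative_X_pow _

/-- Insertion sends `X ^ d` to `d X ^ d + (k n + 1 - d) X ^ (d + 1)`, and `d X ^ d` is `X` times the
derivative of `X ^ d`. -/
theorem descentSeries_succ {k : ℕ} (hk : 0 < k) (n : ℕ) :
    descentSeries k (n + 1) = X * (derivative ℚ (descentSeries k n) * (1 - X) +
      (((k * n : ℕ) : ℚ⟦X⟧) + 1) * descentSeries k n) := by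
  have h : X * (derivative ℚ (descentSeries k n) * (1 - X) +
      (((k * n : ℕ) : ℚ⟦X⟧) + 1) * descentSeries k n) =
      X * derivative ℚ (descentSeries k n) - X * (X * derivative ℚ (descentSeries k n)) +
        X * (((k * n : ℕ) : ℚ⟦X⟧) + 1) * descentSeries k n := by ring
  rw [h, X_mul_derivative_descentSeries, descentSeries, descentSeries,
    sum_stirlingLists_succ hk fun d => (X : ℚ⟦X⟧) ^ d, Finset.mul_sum, Finset.mul_sum,
    ← Finset.sum_sub_distrib, ← Finset.sum_add_distrib]
  refine Finset.sum_congr rfl fun l _ => ?_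
  ring

/-- With `e = k n + 1 - d`, insertion sends `X ^ e` to `(k n + 1 - e) X ^ (e + k) + e X ^ (e + k -
1)`: the operator of `descentSeries_succ` with `X ^ k` in place of the factor `X`. -/
theorem reversedSeries_succ {k : ℕ} (hk : 0 < k) (n : ℕ) :
    reversedSeries k (n + 1) = X ^ k * (derivative ℚ (reversedSeries k n) * (1 - X) +
      (((k * n : ℕ) : ℚ⟦X⟧) + 1) * reversedSeries k n) := by
  obtain ⟨k, rfl⟩ := Nat.exists_eq_succ_of_ne_zero hk.ne'
  have h : X ^ (k + 1) * (derivative ℚ (reversedSeries (k + 1) n) * (1 - X) +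
      ((((k + 1) * n : ℕ) : ℚ⟦X⟧) + 1) * reversedSeries (k + 1) n) =
      X ^ k * (X * derivative ℚ (reversedSeries (k + 1) n)) -
        X ^ (k + 1) * (X * derivative ℚ (reversedSeries (k + 1) n)) +
        X ^ (k + 1) * ((((k + 1) * n : ℕ) : ℚ⟦X⟧) + 1) * reversedSeries (k + 1) n := by ring
  have hd : X * derivative ℚ (reversedSeries (k + 1) n) = ∑ l ∈ stirlingLists (k + 1) n,
      (((k + 1) * n + 1 - desCount l : ℕ) : ℚ⟦X⟧) * X ^ ((k + 1) * n + 1 - desCount l) := by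
    rw [reversedSeries, map_sum, Finset.mul_sum]
    exact Finset.sum_congr rfl fun l _ => X_mul_derivative_X_pow _
  rw [Nat.succ_eq_add_one, h, hd, reversedSeries, reversedSeries,
    sum_stirlingLists_succ hk fun d => (X : ℚ⟦X⟧) ^ ((k + 1) * (n + 1) + 1 - d), Finset.mul_sum,
    Finset.mul_sum, Finset.mul_sum, ← Finset.sum_sub_distrib, ← Finset.sum_add_distrib]
  refine Finset.sum_congr rfl fun l hl => ?_
  -- This bound ensures that none of the natural subtractions in the exponents is truncated.
  have hle : desCount l ≤ (k + 1) * n :=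
    (desCount_le_of_mem hk hl).trans (Nat.le_mul_of_pos_left _ k.succ_pos)
  obtain ⟨e, he⟩ := Nat.exists_eq_add_of_le hle
  have h1 : (k + 1) * n + 1 - desCount l = e + 1 := by omega
  have h2 : (k + 1) * (n + 1) + 1 - desCount l = k + 1 + (e + 1) := by
    rw [Nat.mul_succ]
    omega
  have h3 : (k + 1) * (n + 1) + 1 - (desCount l + 1) = k + (e + 1) := by omega
  rw [h1, h2, h3, he]
  push_cast
  ring

theorem constantCoeff_one_sub_X_pow_ne_zero (e : ℕ) :
    constantCoeff ((1 - X : ℚ⟦X⟧) ^ e) ≠ 0 := by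
  simp

theorem one_sub_X_pow_ne_zero (e : ℕ) : (1 - X : ℚ⟦X⟧) ^ e ≠ 0 := fun h =>
  constantCoeff_one_sub_X_pow_ne_zero e (by rw [h, map_zero])

theorem mul_inv_one_sub_X_pow_mul (f : ℚ⟦X⟧) (e : ℕ) :
    f * ((1 - X) ^ e)⁻¹ * (1 - X) ^ e = f := by
  rw [mul_assoc, PowerSeries.inv_mul_cancel _ (constantCoeff_one_sub_X_pow_ne_zero e), mul_one]

/-- The term from differentiating the power of `1 - X` cancels against the one with the factor `e +
1`. -/
theorem derivative_mul_one_sub_X_pow (g : ℚ⟦X⟧) (e : ℕ) :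
    derivative ℚ (g * (1 - X) ^ (e + 1)) * (1 - X) + ((e : ℚ⟦X⟧) + 1) * (g * (1 - X) ^ (e + 1)) =
      derivative ℚ g * (1 - X) ^ (e + 2) := by
  rw [Derivation.leibniz, Derivation.leibniz_pow, map_sub, derivative_X, Derivation.map_one_eq_zero]
  simp only [smul_eq_mul, nsmul_eq_mul, Nat.add_sub_cancel]
  push_cast
  ring

/-- The common recursion of the two families of series. -/
theorem quotient_succ {a a' f : ℚ⟦X⟧} {e k : ℕ}
    (h : a' = f * (derivative ℚ a * (1 - X) + ((e : ℚ⟦X⟧) + 1) * a)) :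
    a' * ((1 - X) ^ (e + (k + 2) + 1))⁻¹ =
      f * derivative ℚ (a * ((1 - X) ^ (e + 1))⁻¹) *
        PowerSeries.mk fun j => ((k + j).choose k : ℚ) := by
  set g := a * ((1 - X) ^ (e + 1))⁻¹ with hg
  have ha : a = g * (1 - X) ^ (e + 1) := (mul_inv_one_sub_X_pow_mul a (e + 1)).symm
  have hmk : (PowerSeries.mk fun j => ((k + j).choose k : ℚ)) * (1 - X) ^ (k + 1) = 1 := by
    rw [← mk_one_pow_eq_mk_choose_add, ← mul_pow, mk_one_mul_one_sub_eq_one, one_pow]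
  apply mul_right_cancel₀ (one_sub_X_pow_ne_zero (e + (k + 2) + 1))
  rw [mul_inv_one_sub_X_pow_mul, h, ha, derivative_mul_one_sub_X_pow]
  have hexp : e + (k + 2) + 1 = k + 1 + (e + 2) := by ring
  rw [hexp, pow_add (1 - X : ℚ⟦X⟧) (k + 1)]
  linear_combination (-(f * derivative ℚ g * (1 - X) ^ (e + 2))) * hmk

/-- The quotient of the descent polynomial by `(1 - x) ^ (k n + 1)`. -/
noncomputable def descentQuotient (k n : ℕ) : ℚ⟦X⟧ :=
  descentSeries k n * ((1 - X) ^ (k * n + 1))⁻¹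

/-- The quotient of the reversed descent polynomial by `(1 - x) ^ (k n + 1)`. -/
noncomputable def reversedQuotient (k n : ℕ) : ℚ⟦X⟧ :=
  reversedSeries k n * ((1 - X) ^ (k * n + 1))⁻¹

theorem coeff_X_mul_derivative (g : ℚ⟦X⟧) (m : ℕ) :
    coeff m (X * derivative ℚ g) = m * coeff m g := by
  cases m with
  | zero => simp
  | succ m =>
    rw [coeff_succ_X_mul, coeff_derivative, mul_comm]
    push_cast
    rfl

theorem coeff_descentQuotient_succ (k n m : ℕ) :
    coeff m (descentQuotient (k + 2) (n + 1)) = ∑ ij ∈ Finset.HasAntidiagonal.antidiagonal m,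
      ij.1 * coeff ij.1 (descentQuotient (k + 2) n) * ((k + ij.2).choose k : ℚ) := by
  rw [descentQuotient, Nat.mul_succ, quotient_succ (descentSeries_succ (by omega) n), coeff_mul]
  simp only [coeff_X_mul_derivative, coeff_mk]
  rfl

theorem X_pow_mul_mk_choose (k : ℕ) :
    X ^ k * (PowerSeries.mk fun j => ((k + j).choose k : ℚ)) =
      PowerSeries.mk fun j => (j.choose k : ℚ) := by
  ext m
  rw [coeff_X_pow_mul', coeff_mk]
  split_ifs with h
  · rw [coeff_mk, Nat.add_sub_cancel' h]
  · rw [coeff_mk, Nat.choose_eq_zero_of_lt (by omega), Nat.cast_zero]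

/-- Of the factor `X ^ (k + 2)`, one `X` makes the derivative act diagonally on coefficients, `X ^
k` turns the coefficients `(k + j).choose k` into `j.choose k`, and one `X` remains as a shift. -/
theorem reversedQuotient_succ (k n : ℕ) :
    reversedQuotient (k + 2) (n + 1) = X * (X * derivative ℚ (reversedQuotient (k + 2) n) *
      PowerSeries.mk fun j => (j.choose k : ℚ)) := by
  rw [reversedQuotient, Nat.mul_succ, quotient_succ (reversedSeries_succ (by omega) n),
    ← X_pow_mul_mk_choose, reversedQuotient]
  ring

theorem coeff_zero_reversedQuotient_succ (k n : ℕ) :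
    coeff 0 (reversedQuotient (k + 2) (n + 1)) = 0 := by
  rw [reversedQuotient_succ, coeff_zero_X_mul]

theorem coeff_succ_reversedQuotient_succ (k n m : ℕ) :
    coeff (m + 1) (reversedQuotient (k + 2) (n + 1)) = ∑ ij ∈ Finset.HasAntidiagonal.antidiagonal m,
      ij.1 * coeff ij.1 (reversedQuotient (k + 2) n) * (ij.2.choose k : ℚ) := by
  rw [reversedQuotient_succ, coeff_succ_X_mul, coeff_mul]
  simp only [coeff_X_mul_derivative, coeff_mk]

theorem coeff_inv_one_sub_X (m : ℕ) : coeff m ((1 - X : ℚ⟦X⟧)⁻¹) = 1 := by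
  have h : (1 - X : ℚ⟦X⟧)⁻¹ = PowerSeries.mk 1 := by
    rw [eq_comm, PowerSeries.eq_inv_iff_mul_eq_one (by simp), mk_one_mul_one_sub_eq_one]
  rw [h, coeff_mk]
  rfl

theorem coeff_descentQuotient_zero (k m : ℕ) : coeff m (descentQuotient k 0) = 1 := by
  simp [descentQuotient, descentSeries, stirlingLists, desCount, coeff_inv_one_sub_X]

theorem coeff_succ_reversedQuotient_zero (k m : ℕ) :
    coeff (m + 1) (reversedQuotient k 0) = 1 := by
  simp [reversedQuotient, reversedSeries, stirlingLists, desCount, coeff_succ_X_mul,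
    coeff_inv_one_sub_X]

theorem stirlingB_eq {k n : ℕ} (hk : 0 < k) (hn : 0 < n) (m : ℕ) :
    stirlingB (fun _ : Fin n => k) m = coeff m (descentQuotient k n) := by
  have hK : ∑ _a : Fin n, k = k * n := by simp [mul_comm]
  rw [stirlingB, stirlingSeriesG, hK, sum_eulerianNumber hk hn]
  rfl

theorem stirlingb_eq {k n : ℕ} (hk : 0 < k) (hn : 0 < n) (m : ℕ) :
    stirlingb (fun _ : Fin n => k) m = coeff m (reversedQuotient k n) := by
  have hK : ∑ _a : Fin n, k = k * n := by simp [mul_comm]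
  have hnk : n ≤ k * n := Nat.le_mul_of_pos_left _ hk
  rw [stirlingb, stirlingSeriesg, hK, reversedQuotient, reversedSeries,
    ← sum_eulerianNumber hk hn fun d => (X : ℚ⟦X⟧) ^ (k * n + 1 - d)]
  congr 2
  refine Finset.sum_nbij' (fun i => k * n + 1 - i) (fun i => k * n + 1 - i) ?_ ?_ ?_ ?_ ?_
  · intro i hi
    rw [Finset.mem_Icc] at hi ⊢
    omega
  · intro i hi
    rw [Finset.mem_Icc] at hi ⊢
    omega
  · intro i hi
    rw [Finset.mem_Icc] at hi
    omega
  · intro i hi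
    rw [Finset.mem_Icc] at hi
    omega
  · intro i hi
    rw [Finset.mem_Icc] at hi
    rw [Nat.sub_sub_self (by omega)]

end Series

/-! ### Matching the two recursions -/

section Recursions

theorem sum_Icc_one {M : Type*} [AddCommMonoid M] (N : ℕ) (f : ℕ → M) :
    ∑ x ∈ Finset.Icc 1 N, f x = ∑ i ∈ Finset.range N, f (i + 1) := by
  induction N with
  | zero => simp
  | succ N ih => rw [Finset.sum_Icc_succ_top (by omega), ih, Finset.sum_range_succ]

/-- The weighted sum counting the pairs of the second kind. -/
noncomputable def partitionSum (k n N : ℕ) : ℕ :=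
  ∑ D ∈ (Finset.Icc 1 N).powersetCard n, (∏ x ∈ D, (Finset.Ico 1 x \ D).card) *
    gapProd (fun g => (g + k).choose k) N D

/-- The weighted sum counting the pairs of the first kind. -/
noncomputable def permutationSum (k n N : ℕ) : ℕ :=
  ∑ D ∈ (Finset.Icc 1 N).powersetCard n, (∏ x ∈ D, (x - 1)) *
    gapProd (fun g => g.choose k) N D

theorem partitionSum_zero (k N : ℕ) : partitionSum k 0 N = 1 := by
  simp [partitionSum, gapProd]

theorem permutationSum_zero (k N : ℕ) : permutationSum k 0 N = 1 := by
  simp [permutationSum, gapProd]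

/-- Write the maximum of `D` as `x = n + i + 1`. Then `i` minima lie below it and `m - i` elements
above it; for `x ≤ n` there is no room for `n` smaller non-minima. -/
theorem partitionSum_succ (k n m : ℕ) :
    partitionSum k (n + 1) (n + 1 + m) = ∑ ij ∈ Finset.HasAntidiagonal.antidiagonal m,
      ij.1 * partitionSum k n (n + ij.1) * (k + ij.2).choose k := by
  rw [partitionSum, sum_mul_gapProd _ (fun D => ∏ x ∈ D, (Finset.Ico 1 x \ D).card)
    (fun x d => x - 1 - d) fun x D hD hx => prod_card_Ico_sdiff_insert x D hD hx, sum_Icc_one]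
  have hN : n + 1 + m = n + (m + 1) := by ring
  rw [hN, Finset.sum_range_add, Finset.sum_eq_zero, zero_add,
    Finset.Nat.sum_antidiagonal_eq_sum_range_succ
      fun i j => i * partitionSum k n (n + i) * (k + j).choose k]
  · refine Finset.sum_congr rfl fun i hi => ?_
    rw [Finset.mem_range] at hi
    have h1 : n + i + 1 - 1 = n + i := rfl
    have h2 : n + (m + 1) - (n + i + 1) + k = k + (m - i) := by omega
    rw [h1, Nat.add_sub_cancel_left, h2, partitionSum]
    ring
  · intro i hi
    rw [Finset.mem_range] at hi
    rw [Finset.powersetCard_eq_empty.2 (by rw [Nat.card_Icc]; omega), Finset.sum_empty, zero_mul]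

theorem permutationSum_succ (k n N : ℕ) :
    permutationSum k (n + 1) N = ∑ i ∈ Finset.range N,
      i * permutationSum k n i * (N - (i + 1)).choose k := by
  rw [permutationSum, sum_mul_gapProd _ (fun D => ∏ x ∈ D, (x - 1))
    (fun x _ => x - 1) fun x D hD hx => prod_sub_one_insert x D hD hx, sum_Icc_one]
  refine Finset.sum_congr rfl fun i _ => ?_
  rw [Nat.add_sub_cancel, permutationSum]
  ring

theorem partitionSum_eq_coeff (k n m : ℕ) :
    (partitionSum k n (n + m) : ℚ) = PowerSeries.coeff m (descentQuotient (k + 2) n) := by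
  induction n generalizing m with
  | zero => rw [partitionSum_zero, coeff_descentQuotient_zero, Nat.cast_one]
  | succ n ih =>
    rw [partitionSum_succ, coeff_descentQuotient_succ]
    push_cast
    exact Finset.sum_congr rfl fun ij _ => by rw [ih]

/-- The hypothesis carries the factor `i` because the base case fails at `i = 0`: `permutationSum k
0 0` is `1`, while the series `X / (1 - X)` has constant term `0`. The recursion sees only the
products with `i`. -/
theorem permutationSum_succ_eq_coeff_of {k n : ℕ}
    (h : ∀ i : ℕ, (i : ℚ) * permutationSum k n i =
      i * PowerSeries.coeff i (reversedQuotient (k + 2) n)) (m : ℕ) :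
    (permutationSum k (n + 1) m : ℚ) =
      PowerSeries.coeff m (reversedQuotient (k + 2) (n + 1)) := by
  rw [permutationSum_succ]
  cases m with
  | zero => rw [Finset.sum_range_zero, Nat.cast_zero, coeff_zero_reversedQuotient_succ]
  | succ m =>
    rw [coeff_succ_reversedQuotient_succ, Finset.Nat.sum_antidiagonal_eq_sum_range_succ
      fun i j => (i : ℚ) * PowerSeries.coeff i (reversedQuotient (k + 2) n) * (j.choose k : ℚ)]
    push_cast
    refine Finset.sum_congr rfl fun i _ => ?_
    rw [h]

theorem permutationSum_succ_eq_coeff (k n m : ℕ) :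
    (permutationSum k (n + 1) m : ℚ) =
      PowerSeries.coeff m (reversedQuotient (k + 2) (n + 1)) := by
  induction n generalizing m with
  | zero =>
    refine permutationSum_succ_eq_coeff_of (fun i => ?_) m
    cases i with
    | zero => simp
    | succ i => rw [permutationSum_zero, coeff_succ_reversedQuotient_zero, Nat.cast_one]
  | succ n ih => exact permutationSum_succ_eq_coeff_of (fun i => by rw [ih]) m

end Recursions

theorem corollary3 (k n : ℕ) (hk : 2 < k) (hn : 1 ≤ n) (m : ℕ) :
    stirlingB (fun _ : Fin n => k) m = (secondKind k (n + m) m : ℚ) ∧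
    stirlingb (fun _ : Fin n => k) m = (firstKind k m ((m : ℤ) - (n : ℤ)) : ℚ) := by
  obtain ⟨e, rfl⟩ : ∃ e, k = e + 2 := ⟨k - 2, by omega⟩
  obtain ⟨n, rfl⟩ : ∃ n', n = n' + 1 := ⟨n - 1, by omega⟩
  constructor
  · rw [stirlingB_eq (by omega) hn, secondKind_eq_sum hk hn, ← partitionSum_eq_coeff]
    rfl
  · rw [stirlingb_eq (by omega) hn, firstKind_eq_sum hk hn, ← permutationSum_succ_eq_coeff]
    rfl
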